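/- Let $m>0$ and $d,z_1,z_2,z_3,q_1,q_2,q_3,r\in\mathbb R$, and put $$A_z=\begin{bmatrix}0&1&0\\0&0&1\\z_1&z_2&z_3\end{bmatrix},\quad A=\begin{bmatrix}A_z&0\\0&A_e\end{bmatrix},\quad A_e=\begin{bmatrix}0&1&0\\0&0&1\\0&0&-d/m\end{bmatrix},\quad B_2=\begin{bmatrix}0&0&0&0&0&-1/m\end{bmatrix}^T,$$ $$C=\begin{bmatrix}0&0&0&q_1&0&0\\0&0&0&0&q_2&0\\0&0&0&0&0&q_3\\0&0&0&0&0&0\end{bmatrix},\quad D=\begin{bmatrix}0\\0\\0\\r\end{bmatrix},\quad B_1=\operatorname{diag}(b_1,\dots,b_6),\ b_i\in\{0,1\}.$$ Assume that $b_3=1$ or all eigenvalues of $A_z$ have negative real part, and that $b_6=1$ or $q_1\ne0$ (both hold automatically when $B_1=I_6$). For a gain $K\in\mathbb R^{1\times 6}$ let $H(s)=(C-DK)(sI-A+B_2K)^{-1}B_1$ and $\|H\|_\infty=\sup_{\omega\in\mathbb R}\sigma_{\max}(H(j\omega))$. The gain $K$ is called stabilizing if all eigenvalues of $A-B_2K$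 have negative real part, and it is said to have the PID sparsity pattern if $K=[\,0\ \ 0\ \ 0\ \ {-k_i}\ \ {-k_p}\ \ {-k_d}\,]$ for some real $k_i,k_p,k_d$. The sparse optimal $H_\infty$ problem is to minimize $\|H\|_\infty$ over all stabilizing gains $K$ with the PID sparsity pattern. Let $$F=\begin{bmatrix}A&-B_2\\0&0\end{bmatrix},\quad Q=\begin{bmatrix}B_1B_1^T&0\\0&0\end{bmatrix},\quad R=\begin{bmatrix}C^TC&0\\0&D^TD\end{bmatrix},\quad \Theta(W,\mu)=FW+WF^T+WRW+\mu Q,$$ let $\Theta_1(W,\mu)$ be the leading $6\times6$ block of $\Theta(W,\mu)$, partition $W\in\mathbb S^7$ as $W=\begin{bmatrix}W_1&W_2\\W_2^T&W_3\end{bmatrix}$ with $W_1\in\mathbb S^6$, $W_2\in\mathbb R^6$, $W_3\in\mathbb R$, and let $\mathcal L(W)=V_1WV_2$ with $V_1=[\,I_3\ \ 0_{3\times4}\,]$ and $V_2=\begin{bmatrix}0_{3\times4}\\I_4\end{bmatrix}$. Define $$\mathscr C_S=\{(W,\mu)\in\mathbb S^7\times\mathbb R:\ W_1\succ0,\ W\succeq0,\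 \mathcal L(W)=0,\ \Theta_1(W,\mu)\preceq0,\ \mu>0\}.$$ Then: (a) For every $(W,\mu)\in\mathscr C_S$, the matrix $W_1$ is block diagonal with two $3\times3$ blocks, the first three entries of $W_2$ vanish, and $K=W_2^TW_1^{-1}$ is a stabilizing gain with the PID sparsity pattern for which $\|H\|_\infty\le\gamma$, where $\gamma=1/\sqrt\mu>0$. (b) If $(W^*,\mu^*)$ maximizes $\mu$ over $(W,\mu)\in\mathscr C_S$, then $K^*=(W_2^*)^T(W_1^*)^{-1}$ is an optimal solution of the sparse optimal $H_\infty$ problem, and its $H_\infty$-norm, the optimal value, is $\|H\|_\infty^*=\gamma^*=1/\sqrt{\mu^*}$. -/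

import Mathlib

noncomputable section

namespace Maglev

open Matrix
open scoped ENNReal

/-- Parameters of the stage `m y'' + d y' = u`, of the reference generator
`p''' = z₁ p + z₂ p' + z₃ p''`, the weights `q₁, q₂, q₃, r` of the controlled output, and
the diagonal `b` of the disturbance input matrix. -/
structure Params where
  m : ℝ
  d : ℝ
  z₁ : ℝ
  z₂ : ℝ
  z₃ : ℝ
  q₁ : ℝ
  q₂ : ℝ
  q₃ : ℝ
  r : ℝ
  b : Fin 6 → ℝ

/-- A real square matrix is Hurwitz when all its complex eigenvalues have negative real part. -/
def IsHurwitz {n : ℕ} (M : Matrix (Fin n) (Fin n) ℝ) : Prop :=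
  ∀ s ∈ spectrum ℂ (M.map Complex.ofReal), s.re < 0

/-- The maximum singular value: the operator norm for the Euclidean norms. -/
def sigmaMax {k n : ℕ} (M : Matrix (Fin k) (Fin n) ℂ) : ℝ :=
  ‖LinearMap.toContinuousLinearMap (Matrix.toEuclideanLin M)‖

namespace Params

variable (P : Params)

/-- State matrix of the reference generator. -/
def Az : Matrix (Fin 3) (Fin 3) ℝ :=
  !![0, 1, 0;
     0, 0, 1;
     P.z₁, P.z₂, P.z₃]

/-- State matrix for the state `(p, p', p'', e, e', e'')`, without parametric uncertainty. -/
def A : Matrix (Fin 6) (Fin 6) ℝ :=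
  !![0, 1, 0, 0, 0, 0;
     0, 0, 1, 0, 0, 0;
     P.z₁, P.z₂, P.z₃, 0, 0, 0;
     0, 0, 0, 0, 1, 0;
     0, 0, 0, 0, 0, 1;
     0, 0, 0, 0, 0, -(P.d / P.m)]

/-- Disturbance input matrix. -/
def B₁ : Matrix (Fin 6) (Fin 6) ℝ := Matrix.diagonal P.b

/-- Control input matrix. -/
def B₂ : Matrix (Fin 6) (Fin 1) ℝ := !![0; 0; 0; 0; 0; -(1 / P.m)]

/-- Output matrix. -/
def C : Matrix (Fin 4) (Fin 6) ℝ :=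
  !![0, 0, 0, P.q₁, 0, 0;
     0, 0, 0, 0, P.q₂, 0;
     0, 0, 0, 0, 0, P.q₃;
     0, 0, 0, 0, 0, 0]

/-- Feedthrough matrix. -/
def D : Matrix (Fin 4) (Fin 1) ℝ := !![0; 0; 0; P.r]

/-- The closed-loop state matrix under the feedback `-K x`. -/
def closedLoop (K : Matrix (Fin 1) (Fin 6) ℝ) : Matrix (Fin 6) (Fin 6) ℝ := P.A - P.B₂ * K

/-- The gain `K` is stabilizing. -/
def IsStabilizing (K : Matrix (Fin 1) (Fin 6) ℝ) : Prop := IsHurwitz (P.closedLoop K)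

/-- The closed-loop transfer function `H(s) = (C - D K) (s I - A + B₂ K)⁻¹ B₁`. -/
def transfer (K : Matrix (Fin 1) (Fin 6) ℝ) (s : ℂ) : Matrix (Fin 4) (Fin 6) ℂ :=
  (P.C - P.D * K).map Complex.ofReal *
    (s • (1 : Matrix (Fin 6) (Fin 6) ℂ) - (P.closedLoop K).map Complex.ofReal)⁻¹ *
    P.B₁.map Complex.ofReal

/-- `‖H‖_∞ = sup_ω σ_max (H (jω))`, as an extended nonnegative real. -/
def hInfNorm (K : Matrix (Fin 1) (Fin 6) ℝ) : ℝ≥0∞ :=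
  ⨆ ω : ℝ, ENNReal.ofReal (sigmaMax (P.transfer K (Complex.I * (ω : ℂ))))

/-- `F = [A, -B₂; 0, 0]`. -/
def F : Matrix (Fin 7) (Fin 7) ℝ :=
  Matrix.reindex (finSumFinEquiv (m := 6) (n := 1)) (finSumFinEquiv (m := 6) (n := 1))
    (Matrix.fromBlocks P.A (-P.B₂) 0 0)

/-- `Q = [B₁ B₁ᵀ, 0; 0, 0]`. -/
def Q : Matrix (Fin 7) (Fin 7) ℝ :=
  Matrix.reindex (finSumFinEquiv (m := 6) (n := 1)) (finSumFinEquiv (m := 6) (n := 1))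
    (Matrix.fromBlocks (P.B₁ * P.B₁ᵀ) 0 0 0)

/-- `R = [Cᵀ C, 0; 0, Dᵀ D]`. -/
def R : Matrix (Fin 7) (Fin 7) ℝ :=
  Matrix.reindex (finSumFinEquiv (m := 6) (n := 1)) (finSumFinEquiv (m := 6) (n := 1))
    (Matrix.fromBlocks (P.Cᵀ * P.C) 0 0 (P.Dᵀ * P.D))

/-- `Θ(W, μ) = F W + W Fᵀ + W R W + μ Q`. -/
def Θ (W : Matrix (Fin 7) (Fin 7) ℝ) (μ : ℝ) : Matrix (Fin 7) (Fin 7) ℝ :=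
  P.F * W + W * P.Fᵀ + W * P.R * W + μ • P.Q

end Params

/-- The leading `6 × 6` block of a `7 × 7` matrix. -/
def block₁ (W : Matrix (Fin 7) (Fin 7) ℝ) : Matrix (Fin 6) (Fin 6) ℝ :=
  W.submatrix (Fin.castAdd 1) (Fin.castAdd 1)

/-- The upper right `6 × 1` block of a `7 × 7` matrix. -/
def block₂ (W : Matrix (Fin 7) (Fin 7) ℝ) : Matrix (Fin 6) (Fin 1) ℝ :=
  W.submatrix (Fin.castAdd 1) (Fin.natAdd 6)

/-- `V₁ = [I₃, 0]`. -/
def V₁ : Matrix (Fin 3) (Fin 7) ℝ :=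
  Matrix.reindex (Equiv.refl (Fin 3)) (finSumFinEquiv (m := 3) (n := 4))
    (Matrix.fromCols (1 : Matrix (Fin 3) (Fin 3) ℝ) (0 : Matrix (Fin 3) (Fin 4) ℝ))

/-- `V₂ = [0; I₄]`. -/
def V₂ : Matrix (Fin 7) (Fin 4) ℝ :=
  Matrix.reindex (finSumFinEquiv (m := 3) (n := 4)) (Equiv.refl (Fin 4))
    (Matrix.fromRows (0 : Matrix (Fin 3) (Fin 4) ℝ) (1 : Matrix (Fin 4) (Fin 4) ℝ))

/-- The linear operator `L(W) = V₁ W V₂`. -/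
def L (W : Matrix (Fin 7) (Fin 7) ℝ) : Matrix (Fin 3) (Fin 4) ℝ := V₁ * W * V₂

/-- The gain `K = W₂ᵀ W₁⁻¹` generated by `W`. -/
def gain (W : Matrix (Fin 7) (Fin 7) ℝ) : Matrix (Fin 1) (Fin 6) ℝ :=
  (block₂ W)ᵀ * (block₁ W)⁻¹

/-- The prescribed (PID) sparsity pattern of a gain. -/
def HasPIDPattern (K : Matrix (Fin 1) (Fin 6) ℝ) : Prop :=
  ∃ kᵢ kₚ k_d : ℝ, K = !![0, 0, 0, -kᵢ, -kₚ, -k_d]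

namespace Params

variable (P : Params)

/-- The feasible set: symmetric `W` partitioned with `W₁ ≻ 0`, with `W ⪰ 0`, `L(W) = 0`,
`Θ₁(W, μ) ⪯ 0` and `μ > 0`. -/
def feasible : Set (Matrix (Fin 7) (Fin 7) ℝ × ℝ) :=
  {p | (block₁ p.1).PosDef ∧ p.1.PosSemidef ∧ L p.1 = 0 ∧
    (-(block₁ (P.Θ p.1 p.2))).PosSemidef ∧ 0 < p.2}

/-- `K` solves the sparse optimal `H_∞` problem: it minimizes `‖H‖_∞` among the
stabilizing gains with the prescribed sparsity pattern. -/
def IsSparseOptimal (K : Matrix (Fin 1) (Fin 6) ℝ) : Prop :=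
  HasPIDPattern K ∧ P.IsStabilizing K ∧
    ∀ K' : Matrix (Fin 1) (Fin 6) ℝ, HasPIDPattern K' → P.IsStabilizing K' →
      P.hInfNorm K ≤ P.hInfNorm K'

end Params

end Maglev

end

noncomputable section

namespace Maglev

open Matrix
open scoped ENNReal ComplexOrder

/-! The bounded real lemma converts ‖H‖_∞ ≤ γ into a Riccati inequality for the closed loop with μ =
γ⁻². Since CᵀD = 0, the substitution W₂ = W₁Kᵀ turns Θ₁ into exactly this Riccati expression at W₁
(`block₁_Θ`), and L(W) = 0 makes W₁ block diagonal, which forces the PID pattern on K. What remains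
is to pass between the Riccati inequality and the norm, in both directions.

From feasibility to the norm: the inequality is not strict, so stability is not automatic. An
unstable mode would have to lie on the imaginary axis, be unreachable through B₁, and give an
unobservable vector W₁v (`exists_left_eigenvector_of_riccati`); the conditions on b₃, A_z, b₆ and q₁
exclude this. Completing a square then bounds the frequency response.

From the norm to feasibility: for a PID gain of norm below γ, the strict bounded real lemma
(`IsHurwitz.exists_bounded_real`) yields a Lyapunov matrix. The closed loop decouples into two
blocks, so it is invariant under changing the sign of the first three states; averaging over this
reflection makes the matrix block diagonal, and its inverse serves as W₁. Sparsity therefore costs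
nothing, and a gain with norm below 1/√μ* would produce a feasible μ > μ*.

The strict lemma is proved by duality. If its matrix inequality is infeasible, a semidefinite
multiplier exists; factored, it satisfies a skewness relation that splits it over ℂ into
single-frequency trajectories, each obeying the norm bound. Summing contradicts the multiplier. -/

/-! ### Theorem of alternatives for matrix inequalities -/

/-- By homogeneity it suffices to test the compact unit sphere. Symmetry of T is not required, so
that later inequalities may be written with nonsymmetric matrices. -/
theorem isOpen_setOf_quadratic_neg {ι : Type*} [Fintype ι] :
    IsOpen {T : Matrix ι ι ℝ | ∀ z : ι → ℝ, z ≠ 0 → z ⬝ᵥ T *ᵥ z < 0} := by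
  have hset : {T : Matrix ι ι ℝ | ∀ z : ι → ℝ, z ≠ 0 → z ⬝ᵥ T *ᵥ z < 0} =
      {T : Matrix ι ι ℝ | ∀ z ∈ Metric.sphere (0 : ι → ℝ) 1, z ⬝ᵥ T *ᵥ z < 0} := by
    ext T
    constructor
    · intro h z hz
      refine h z ?_
      rintro rfl
      simp at hz
    · intro h z hz
      have hn : 0 < ‖z‖ := norm_pos_iff.2 hz
      have := h (‖z‖⁻¹ • z) (by simp [norm_smul, hn.ne'])
      rw [mulVec_smul, dotProduct_smul, smul_dotProduct, smul_eq_mul, smul_eq_mul] at this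
      by_contra hcon
      push Not at hcon
      have : 0 ≤ ‖z‖⁻¹ * (‖z‖⁻¹ * z ⬝ᵥ T *ᵥ z) := by positivity
      linarith
  rw [hset, isOpen_iff_eventually]
  intro T hT
  refine (isCompact_sphere (0 : ι → ℝ) 1).eventually_forall_of_forall_eventually ?_
  intro z hz
  have hc : Continuous fun p : Matrix ι ι ℝ × (ι → ℝ) => p.2 ⬝ᵥ p.1 *ᵥ p.2 := by fun_prop
  exact hc.continuousAt.eventually_lt continuousAt_const (hT z hz)

theorem linear_eq_trace {ι : Type*} [Fintype ι] [DecidableEq ι] (f : Matrix ι ι ℝ →ₗ[ℝ] ℝ)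
    (T : Matrix ι ι ℝ) :
    f T = trace ((Matrix.of fun i j => f (single j i 1)) * T) := by
  conv_lhs => rw [matrix_eq_sum_single T]
  simp only [map_sum, trace, diag_apply, mul_apply, of_apply]
  rw [Finset.sum_comm]
  refine Finset.sum_congr rfl fun i _ => Finset.sum_congr rfl fun j _ => ?_
  have : single j i (T j i) = T j i • single j i (1 : ℝ) := by simp
  rw [this, map_smul, smul_eq_mul, mul_comm]

/-- Theorem of alternatives for strict linear matrix inequalities. -/
theorem exists_posSemidef_of_not_exists_neg {ι : Type*} [Fintype ι] [DecidableEq ι] {V : Type*}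
    [AddCommGroup V] [Module ℝ V] (l : V →ₗ[ℝ] Matrix ι ι ℝ) (M : Matrix ι ι ℝ)
    (h : ¬ ∃ X, ∀ z : ι → ℝ, z ≠ 0 → z ⬝ᵥ (l X + M) *ᵥ z < 0) :
    ∃ Z : Matrix ι ι ℝ, Z.PosSemidef ∧ Z ≠ 0 ∧ (∀ X, trace (Z * l X) = 0) ∧
      0 ≤ trace (Z * M) := by
  set s : Set (Matrix ι ι ℝ) := {T | ∀ z : ι → ℝ, z ≠ 0 → z ⬝ᵥ T *ᵥ z < 0} with hs
  set t : Set (Matrix ι ι ℝ) := Set.range fun X => l X + M with ht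
  have hsc : Convex ℝ s := by
    intro S hS T hT a b ha hb hab z hz
    have h1 := hS z hz
    have h2 := hT z hz
    rw [add_mulVec, smul_mulVec, smul_mulVec, dotProduct_add, dotProduct_smul, dotProduct_smul,
      smul_eq_mul, smul_eq_mul]
    rcases ha.eq_or_lt with rfl | ha
    · have : b = 1 := by linarith
      subst this; linarith
    · nlinarith [mul_pos_of_neg_of_neg h1 (neg_neg_of_pos ha)]
  have htc : Convex ℝ t := by
    rintro _ ⟨X, rfl⟩ _ ⟨Y, rfl⟩ a b ha hb hab
    refine ⟨a • X + b • Y, ?_⟩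
    simp only [map_add, map_smul, smul_add]
    have : M = a • M + b • M := by rw [← add_smul, hab, one_smul]
    conv_lhs => rw [this]
    abel
  have hdisj : Disjoint s t := by
    rw [Set.disjoint_left]
    rintro _ hT ⟨X, rfl⟩
    exact h ⟨X, hT⟩
  obtain ⟨f, u, hfs, hft⟩ := geometric_hahn_banach_open hsc isOpen_setOf_quadratic_neg htc hdisj
  have hscale : ∀ T ∈ s, ∀ c : ℝ, 0 < c → c • T ∈ s := by
    intro T hT c hc z hz
    rw [smul_mulVec, dotProduct_smul, smul_eq_mul]
    exact mul_neg_of_pos_of_neg hc (hT z hz)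
  have hone : (-1 : Matrix ι ι ℝ) ∈ s := by
    intro z hz
    rw [neg_mulVec, one_mulVec, dotProduct_neg, neg_lt_zero]
    simpa using dotProduct_star_self_pos_iff.2 hz
  have hneg : ∀ T ∈ s, f T ≤ 0 := by
    intro T hT
    by_contra hcon
    push Not at hcon
    -- The factor makes the value of `f` equal to |u| + 1, above the separating level.
    have h1 := hfs _ (hscale T hT ((|u| + 1) / f T) (by positivity))
    rw [map_smul, smul_eq_mul, div_mul_cancel₀ _ hcon.ne'] at h1
    linarith [le_abs_self u]
  have hu : 0 ≤ u := by
    by_contra hcon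
    push Not at hcon
    have h0 := hneg _ hone
    -- A multiple of -1 this small has an `f`-value above `u`, since a cone accumulates at 0.
    have h1 := hfs _ (hscale _ hone (-u / (2 * (|f (-1)| + 1))) (by
      have : 0 < -u := by linarith
      positivity))
    rw [map_smul, smul_eq_mul, div_mul_eq_mul_div, div_lt_iff₀ (by positivity)] at h1
    have := neg_abs_le (f (-1))
    nlinarith
  -- `f` is bounded below on the affine image, so it must vanish on its direction space.
  have hfl : ∀ X, f (l X) = 0 := by
    intro X
    by_contra hcon
    have h1 := hft _ ⟨((-(|f M| + 1)) / f (l X)) • X, rfl⟩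
    simp only [map_smul, map_add, smul_eq_mul] at h1
    rw [div_mul_cancel₀ _ hcon] at h1
    linarith [le_abs_self (f M)]
  have hfM : 0 ≤ f M := by
    have h1 := hft _ ⟨0, rfl⟩
    simp only [map_zero, zero_add] at h1
    linarith
  -- Perturb T by -ε and let ε tend to 0.
  have hclos : ∀ T : Matrix ι ι ℝ, (∀ z, z ⬝ᵥ T *ᵥ z ≤ 0) → f T ≤ 0 := by
    intro T hT
    have h1 : ∀ ε : ℝ, 0 < ε → f T ≤ ε * (-f (-1)) := by
      intro ε hε
      have := hneg (T + ε • (-1)) (by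
        intro z hz
        rw [add_mulVec, dotProduct_add]
        have h2 := hscale _ hone ε hε z hz
        linarith [hT z])
      rw [map_add, map_smul, smul_eq_mul] at this
      linarith
    have hone' := hneg _ hone
    by_contra hcon
    push Not at hcon
    have := h1 (f T / (2 * (-f (-1) + 1))) (by
      have : 0 < -f (-1) + 1 := by linarith
      positivity)
    rw [div_mul_eq_mul_div, le_div_iff₀ (by linarith)] at this
    nlinarith
  set Z : Matrix ι ι ℝ := Matrix.of fun i j => f (single j i 1) with hZ
  have hfZ : ∀ T, f T = trace (Z * T) := fun T => linear_eq_trace (f : Matrix ι ι ℝ →ₗ[ℝ] ℝ) T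
  refine ⟨Z, ?_, ?_, fun X => by rw [← hfZ, hfl], by rwa [← hfZ]⟩
  · refine PosSemidef.of_dotProduct_mulVec_nonneg ?_ ?_
    · ext i j
      -- A skew matrix has zero quadratic form, so `f` is nonpositive on it and on its negative;
      -- hence Z is symmetric.
      have hsk : ∀ c : ℝ, c * f (single i j (1 : ℝ) - single j i 1) ≤ 0 := by
        intro c
        have := hclos (c • (single i j (1 : ℝ) - single j i 1)) (by
          intro z
          rw [smul_mulVec, sub_mulVec, dotProduct_smul, dotProduct_sub, single_mulVec,
            single_mulVec]
          have e : ∀ (k : ι) (a : ℝ), z ⬝ᵥ Function.update 0 k a = z k * a := fun k a => by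
            rw [show Function.update (0 : ι → ℝ) k a = Pi.single k a from rfl, dotProduct_single]
          rw [e, e]
          simp [mul_comm])
        rwa [map_smul, smul_eq_mul] at this
      have h1 := hsk 1
      have h2 := hsk (-1)
      rw [map_sub] at h1 h2
      simp only [hZ, conjTranspose_apply, of_apply, star_trivial]
      linarith
    · intro z
      have h1 := hclos (-vecMulVec z z) (by
        intro y
        rw [neg_mulVec, dotProduct_neg, vecMulVec_mulVec, dotProduct_smul]
        simp only [MulOpposite.smul_eq_mul_unop, MulOpposite.unop_op]
        rw [dotProduct_comm y z]
        nlinarith [mul_self_nonneg (z ⬝ᵥ y)])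
      rw [map_neg, hfZ, mul_vecMulVec, trace_vecMulVec, dotProduct_comm] at h1
      rw [star_trivial]
      linarith
  · intro hZ0
    have h1 := hfs _ hone
    have h2 := hft _ ⟨0, rfl⟩
    simp only [hfZ, hZ0, zero_mul, trace_zero] at h1 h2
    linarith

/-! ### Eigenvalues, complexification and Lyapunov's theorem -/

theorem mem_spectrum_iff_exists_mulVec {n : Type*} [Fintype n] [DecidableEq n]
    {M : Matrix n n ℂ} {s : ℂ} : s ∈ spectrum ℂ M ↔ ∃ v, v ≠ 0 ∧ M *ᵥ v = s • v := by
  rw [← spectrum_toLin', ← Module.End.hasEigenvalue_iff_mem_spectrum]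
  constructor
  · intro h
    obtain ⟨v, hv⟩ := h.exists_hasEigenvector
    exact ⟨v, hv.2, by simpa using hv.apply_eq_smul⟩
  · rintro ⟨v, h0, hv⟩
    exact Module.End.hasEigenvalue_of_hasEigenvector
      (x := v) ⟨Module.End.mem_eigenspace_iff.2 (by simpa using hv), h0⟩

theorem map_ofReal_mul {l m n : Type*} [Fintype m] (A : Matrix l m ℝ) (B : Matrix m n ℝ) :
    (A * B).map Complex.ofReal = A.map Complex.ofReal * B.map Complex.ofReal :=
  Matrix.map_mul (f := Complex.ofRealHom)

theorem map_ofReal_add {m n : Type*} (A B : Matrix m n ℝ) :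
    (A + B).map Complex.ofReal = A.map Complex.ofReal + B.map Complex.ofReal := by
  ext i j; simp

theorem map_ofReal_conjTranspose {m n : Type*} (A : Matrix m n ℝ) :
    (A.map Complex.ofReal)ᴴ = Aᵀ.map Complex.ofReal := by
  ext i j; simp

theorem exists_eq_transpose_mul_self {n : Type*} [Fintype n] {Z : Matrix n n ℝ}
    (hZ : Z.PosSemidef) : ∃ (k : ℕ) (R : Matrix (Fin k) n ℝ), Z = Rᵀ * R := by
  obtain ⟨k, v, rfl⟩ := posSemidef_iff_eq_sum_vecMulVec.1 hZ
  refine ⟨k, Matrix.of v, ?_⟩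
  ext i j
  simp [Matrix.sum_apply, mul_apply, vecMulVec_apply]

theorem posSemidef_map_ofReal {n : Type*} [Fintype n] {Z : Matrix n n ℝ}
    (hZ : Z.PosSemidef) : (Z.map Complex.ofReal).PosSemidef := by
  obtain ⟨k, R, rfl⟩ := exists_eq_transpose_mul_self hZ
  rw [map_ofReal_mul, ← map_ofReal_conjTranspose]
  exact posSemidef_conjTranspose_mul_self _

/-- The range of a Hermitian matrix is the orthogonal complement of its kernel. -/
theorem exists_mulVec_eq_of_hermitian {n : Type*} [Fintype n] [DecidableEq n] {Z : Matrix n n ℂ}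
    (hZ : Z.IsHermitian) {w : n → ℂ} (hw : ∀ v, Z *ᵥ v = 0 → star v ⬝ᵥ w = 0) :
    ∃ u, Z *ᵥ u = w := by
  have hsym : (toEuclideanLin Z).IsSymmetric := isSymmetric_toEuclideanLin_iff.2 hZ
  have hmem : WithLp.toLp 2 w ∈ (LinearMap.range (toEuclideanLin Z)) := by
    rw [← Submodule.orthogonal_orthogonal (LinearMap.range (toEuclideanLin Z)),
      hsym.orthogonal_range, Submodule.mem_orthogonal]
    intro u hu
    have h1 : Z *ᵥ (WithLp.ofLp u) = 0 := by
      have := LinearMap.mem_ker.1 hu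
      simpa [toLpLin_apply] using this
    have h2 := hw _ h1
    rw [EuclideanSpace.inner_eq_star_dotProduct, dotProduct_comm]
    exact h2
  obtain ⟨u, hu⟩ := hmem
  exact ⟨WithLp.ofLp u, by simpa [toLpLin_apply] using congrArg WithLp.ofLp hu⟩

/-- A nonzero `Z ⪰ 0` with `A Z + Z Aᴴ ⪰ 0` forces an eigenvalue in the closed right half plane. -/
theorem exists_spectrum_re_nonneg {n : Type*} [Fintype n] [DecidableEq n] {A Z : Matrix n n ℂ}
    (hZ : Z.PosSemidef) (hZ0 : Z ≠ 0) (h : (A * Z + Z * Aᴴ).PosSemidef) :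
    ∃ s ∈ spectrum ℂ A, 0 ≤ s.re := by
  -- On ker Z the form of A Z + Z Aᴴ vanishes, so by semidefiniteness the matrix itself kills v.
  -- Thus ker Z is Aᴴ-invariant and, dually, the range of Z is A-invariant; an eigenvector of A in
  -- that range is the one sought.
  have hker : ∀ v, Z *ᵥ v = 0 → Z *ᵥ (Aᴴ *ᵥ v) = 0 := by
    intro v hv
    have hv' : star v ᵥ* Z = 0 := by
      have := congrArg star hv
      rwa [star_mulVec, hZ.1.eq, star_zero] at this
    have h1 : star v ⬝ᵥ (A * Z + Z * Aᴴ) *ᵥ v = 0 := by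
      rw [add_mulVec, dotProduct_add, ← mulVec_mulVec, hv, mulVec_zero, dotProduct_zero, zero_add,
        ← mulVec_mulVec, dotProduct_mulVec, hv', zero_dotProduct]
    have h2 := (h.dotProduct_mulVec_zero_iff v).1 h1
    rwa [add_mulVec, ← mulVec_mulVec, hv, mulVec_zero, zero_add, ← mulVec_mulVec] at h2
  have hinv : ∀ w ∈ LinearMap.range Z.mulVecLin, A.mulVecLin w ∈ LinearMap.range Z.mulVecLin := by
    rintro _ ⟨u, rfl⟩
    obtain ⟨y, hy⟩ := exists_mulVec_eq_of_hermitian hZ.1 (w := A *ᵥ (Z *ᵥ u)) (by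
      intro v hv
      have h1 := congrArg star (hker v hv)
      rw [star_mulVec, star_mulVec, hZ.1.eq, star_zero, conjTranspose_conjTranspose] at h1
      rw [dotProduct_mulVec, dotProduct_mulVec, h1, zero_dotProduct])
    exact ⟨y, by simpa using hy⟩
  have : Nontrivial (LinearMap.range Z.mulVecLin) := by
    rw [Submodule.nontrivial_iff_ne_bot, ne_eq, LinearMap.range_eq_bot]
    intro h0
    apply hZ0
    ext i j
    have := congrFun (LinearMap.congr_fun h0 (Pi.single j 1)) i
    simpa using this
  obtain ⟨s, hs⟩ := Module.End.exists_eigenvalue (A.mulVecLin.restrict hinv)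
  obtain ⟨⟨_, v, rfl⟩, hw⟩ := hs.exists_hasEigenvector
  have hne : Z *ᵥ v ≠ 0 := fun h0 => hw.2 (Subtype.ext (by simpa using h0))
  have heig : A *ᵥ (Z *ᵥ v) = s • (Z *ᵥ v) := by
    have := congrArg Subtype.val hw.apply_eq_smul
    simpa using this
  refine ⟨s, mem_spectrum_iff_exists_mulVec.2 ⟨_, hne, heig⟩, ?_⟩
  have h1 := h.dotProduct_mulVec_nonneg v
  have h2 := hZ.dotProduct_mulVec_nonneg v
  have h3 : star v ⬝ᵥ Z *ᵥ v ≠ 0 := fun h0 => hne ((hZ.dotProduct_mulVec_zero_iff v).1 h0)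
  have h4 : star v ᵥ* (Z * Aᴴ) = star s • (star v ᵥ* Z) := by
    have := congrArg star heig
    rw [star_smul, star_mulVec, star_mulVec, hZ.1.eq] at this
    rw [← vecMul_vecMul, this]
  rw [add_mulVec, dotProduct_add, ← mulVec_mulVec, heig, dotProduct_smul,
    dotProduct_mulVec _ (Z * Aᴴ), h4, smul_dotProduct, ← dotProduct_mulVec, smul_eq_mul, smul_eq_mul, ← add_mul] at h1
  have h5 : s + star s = ((2 * s.re : ℝ) : ℂ) := by
    rw [Complex.star_def, Complex.add_conj]
  obtain ⟨r, hr⟩ : ∃ r : ℝ, star v ⬝ᵥ Z *ᵥ v = r := ⟨_, Complex.eq_re_of_ofReal_le h2⟩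
  rw [hr] at h1 h2 h3
  rw [h5, ← Complex.ofReal_mul] at h1
  have h1' := Complex.zero_le_real.1 h1
  have h2' := Complex.zero_le_real.1 h2
  have h3' : r ≠ 0 := by simpa using h3
  have : 0 < r := lt_of_le_of_ne h2' h3'.symm
  by_contra hcon
  push Not at hcon
  nlinarith

theorem eq_zero_of_forall_trace_mul {m n : Type*} [Fintype m] [Fintype n] [DecidableEq m]
    [DecidableEq n] {S : Matrix m n ℝ} (h : ∀ Y : Matrix n m ℝ, trace (S * Y) = 0) : S = 0 := by
  have := h Sᵀ
  rw [← conjTranspose_eq_transpose_of_trivial] at this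
  exact trace_mul_conjTranspose_self_eq_zero_iff.1 this

/-- The symmetrised product `Y ↦ (Y + Yᵀ) A`. -/
def symMul {n m : Type*} [Fintype n] (A : Matrix n m ℝ) : Matrix n n ℝ →ₗ[ℝ] Matrix n m ℝ where
  toFun Y := (Y + Yᵀ) * A
  map_add' X Y := by rw [transpose_add, ← Matrix.add_mul]; congr 1; abel
  map_smul' c Y := by simp [Matrix.add_mul]

@[simp]
theorem symMul_apply {n m : Type*} [Fintype n] (A : Matrix n m ℝ) (Y : Matrix n n ℝ) :
    symMul A Y = (Y + Yᵀ) * A := rfl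

theorem trace_mul_symm_mul {n m : Type*} [Fintype n] [Fintype m] (Z : Matrix m n ℝ)
    (Y : Matrix n n ℝ) (A : Matrix n m ℝ) :
    trace (Z * ((Y + Yᵀ) * A)) = trace ((A * Z + (A * Z)ᵀ) * Y) := by
  rw [← Matrix.mul_assoc, trace_mul_comm, Matrix.mul_add, Matrix.mul_add, trace_add,
    Matrix.add_mul, trace_add, ← Matrix.mul_assoc, ← Matrix.mul_assoc]
  congr 1
  rw [← trace_transpose, transpose_mul, transpose_transpose, trace_mul_comm]

theorem dotProduct_fromBlocks_mulVec {m n : Type*} [Fintype m] [Fintype n] (A : Matrix m m ℝ)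
    (B : Matrix m n ℝ) (C : Matrix n m ℝ) (D : Matrix n n ℝ) (x : m → ℝ) (u : n → ℝ) :
    Sum.elim x u ⬝ᵥ fromBlocks A B C D *ᵥ Sum.elim x u =
      x ⬝ᵥ A *ᵥ x + x ⬝ᵥ B *ᵥ u + u ⬝ᵥ C *ᵥ x + u ⬝ᵥ D *ᵥ u := by
  rw [fromBlocks_mulVec, sumElim_dotProduct_sumElim]
  simp only [Sum.elim_comp_inl, Sum.elim_comp_inr, dotProduct_add]
  ring

theorem trace_fromBlocks {m n : Type*} [Fintype m] [Fintype n] (A : Matrix m m ℝ)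
    (B : Matrix m n ℝ) (C : Matrix n m ℝ) (D : Matrix n n ℝ) :
    trace (fromBlocks A B C D) = trace A + trace D := by
  simp [trace]

/-- Lyapunov's theorem: a Hurwitz matrix has a quadratic Lyapunov function. -/
theorem IsHurwitz.exists_posDef {n : ℕ} {A : Matrix (Fin n) (Fin n) ℝ} (hA : IsHurwitz A) :
    ∃ X : Matrix (Fin n) (Fin n) ℝ, X.PosDef ∧ ∀ x, x ≠ 0 → x ⬝ᵥ (X * A) *ᵥ x < 0 := by
  by_contra hcon
  obtain ⟨Z, hZ, hZ0, hl, -⟩ := exists_posSemidef_of_not_exists_neg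
    (V := Matrix (Fin n) (Fin n) ℝ)
    -- The diagonal blocks encode the Lyapunov inequality and positivity of Y + Yᵀ at once. The
    -- multiplier then satisfies A Z₁ + Z₁ Aᵀ = 2 Z₂ ⪰ 0, which a Hurwitz matrix forbids.
    (l := { toFun := fun Y => fromBlocks (symMul A Y) 0 0 (-symMul 1 Y)
            map_add' := fun X Y => by
              rw [map_add, map_add, fromBlocks_add, neg_add]; simp
            map_smul' := fun c Y => by
              rw [map_smul, map_smul, RingHom.id_apply, fromBlocks_smul, smul_neg]; simp })
    (M := 0) (by
      rintro ⟨Y, hY⟩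
      apply hcon
      have hsymm : (Y + Yᵀ)ᵀ = Y + Yᵀ := by rw [transpose_add, transpose_transpose, add_comm]
      refine ⟨Y + Yᵀ, PosDef.of_dotProduct_mulVec_pos ?_ ?_, ?_⟩
      · rw [IsHermitian, conjTranspose_eq_transpose_of_trivial, hsymm]
      · intro x hx
        have := hY (Sum.elim 0 x) (fun h0 => hx (by
          funext i; exact congrFun h0 (Sum.inr i)))
        simp only [LinearMap.coe_mk, AddHom.coe_mk, add_zero] at this
        rw [dotProduct_fromBlocks_mulVec] at this
        rw [symMul_apply 1, Matrix.mul_one, neg_mulVec, dotProduct_neg] at this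
        simpa using this
      · intro x hx
        have := hY (Sum.elim x 0) (fun h0 => hx (by
          funext i; exact congrFun h0 (Sum.inl i)))
        simp only [LinearMap.coe_mk, AddHom.coe_mk, add_zero] at this
        rw [dotProduct_fromBlocks_mulVec] at this
        simpa using this)
  obtain ⟨Z₁, Z₁₂, Z₂₁, Z₂, rfl⟩ : ∃ Z₁ Z₁₂ Z₂₁ Z₂, Z = fromBlocks Z₁ Z₁₂ Z₂₁ Z₂ :=
    ⟨_, _, _, _, (fromBlocks_toBlocks Z).symm⟩
  have hZ₁ : Z₁.PosSemidef := hZ.submatrix Sum.inl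
  have hZ₂ : Z₂.PosSemidef := hZ.submatrix Sum.inr
  have h1 : A * Z₁ + Z₁ * Aᵀ = Z₂ + Z₂ := by
    have hs1 : Z₁ᵀ = Z₁ := by simpa using hZ₁.1.eq
    have hs2 : Z₂ᵀ = Z₂ := by simpa using hZ₂.1.eq
    rw [← sub_eq_zero]
    apply eq_zero_of_forall_trace_mul
    intro Y
    have h := hl Y
    simp only [LinearMap.coe_mk, AddHom.coe_mk, symMul_apply, fromBlocks_multiply,
      trace_fromBlocks, Matrix.mul_zero, add_zero, zero_add, Matrix.mul_neg, trace_neg] at h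
    rw [trace_mul_symm_mul, trace_mul_symm_mul, Matrix.one_mul,
      transpose_mul, hs1, hs2, ← sub_eq_add_neg, ← trace_sub, ← Matrix.sub_mul] at h
    exact h
  have hZ₁0 : Z₁ ≠ 0 := by
    rintro rfl
    apply hZ0
    rw [← hZ.trace_eq_zero_iff, trace_fromBlocks]
    have : Z₂ = 0 := by
      ext i j
      have := congrFun (congrFun h1 i) j
      simp at this
      simpa using by linarith
    rw [this]; simp
  obtain ⟨s, hs, hs0⟩ := exists_spectrum_re_nonneg (posSemidef_map_ofReal hZ₁)
    (A := A.map Complex.ofReal) (fun h0 => hZ₁0 (by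
      ext i j
      simpa using congrFun (congrFun h0 i) j))
    (by
      rw [map_ofReal_conjTranspose, ← map_ofReal_mul, ← map_ofReal_mul, ← map_ofReal_add, h1]
      exact posSemidef_map_ofReal (hZ₂.add hZ₂))
  exact absurd (hA s hs) (not_lt.2 hs0)

/-- For a Hurwitz matrix every solution of the strict Lyapunov inequality is positive definite. -/
theorem IsHurwitz.posDef_of_lyapunov {n : ℕ} {A X : Matrix (Fin n) (Fin n) ℝ} (hA : IsHurwitz A)
    (hX : X.IsHermitian) (h : ∀ x, x ≠ 0 → x ⬝ᵥ (X * A) *ᵥ x < 0) : X.PosDef := by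
  obtain ⟨P, hP, hPA⟩ := hA.exists_posDef
  refine PosDef.of_dotProduct_mulVec_pos hX ?_
  intro y hy
  rw [star_trivial]
  have hPpos : ∀ x, x ≠ 0 → 0 < x ⬝ᵥ P *ᵥ x := fun x hx => by
    simpa using hP.dotProduct_mulVec_pos hx
  have hne0 : ∀ z ∈ Metric.sphere (0 : Fin n → ℝ) 1, z ≠ 0 := by
    rintro z hz rfl
    simp at hz
  -- Minimize the Rayleigh quotient of X relative to P. If the minimum c were ≤ 0, the minimizer x₀
  -- would lie in the kernel of X - cP ⪰ 0, so x₀ᵀXAx₀ = c x₀ᵀPAx₀ ≥ 0.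
  obtain ⟨x₀, hx₀, hmin⟩ := (isCompact_sphere (0 : Fin n → ℝ) 1).exists_isMinOn
    ⟨‖y‖⁻¹ • y, by simp [norm_smul, hy]⟩
    (f := fun x => (x ⬝ᵥ X *ᵥ x) / (x ⬝ᵥ P *ᵥ x))
    (ContinuousOn.div (by fun_prop) (by fun_prop) fun z hz => (hPpos z (hne0 z hz)).ne')
  set c := (x₀ ⬝ᵥ X *ᵥ x₀) / (x₀ ⬝ᵥ P *ᵥ x₀) with hc
  have hx₀0 := hne0 x₀ hx₀
  have hlow : ∀ x, c * (x ⬝ᵥ P *ᵥ x) ≤ x ⬝ᵥ X *ᵥ x := by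
    intro x
    by_cases hx : x = 0
    · simp [hx]
    have h1 := hmin (a := ‖x‖⁻¹ • x) (by simp [norm_smul, hx])
    simp only [Set.mem_ofPred_eq, mulVec_smul, dotProduct_smul, smul_dotProduct, smul_eq_mul] at h1
    have hn : ‖x‖⁻¹ ≠ 0 := by simpa using hx
    rw [mul_div_mul_left _ _ hn, mul_div_mul_left _ _ hn, ← hc, le_div_iff₀ (hPpos x hx)] at h1
    exact h1
  suffices 0 < c from lt_of_lt_of_le (mul_pos this (hPpos y hy)) (hlow y)
  by_contra hcn
  push Not at hcn
  have hpsd : (X - c • P).PosSemidef := by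
    refine PosSemidef.of_dotProduct_mulVec_nonneg ?_ ?_
    · have := hP.1
      rw [IsHermitian, conjTranspose_eq_transpose_of_trivial] at *
      rw [transpose_sub, transpose_smul, hX, this]
    · intro x
      rw [star_trivial, sub_mulVec, dotProduct_sub, smul_mulVec, dotProduct_smul, smul_eq_mul]
      linarith [hlow x]
  have hzero : (X - c • P) *ᵥ x₀ = 0 := by
    rw [← hpsd.dotProduct_mulVec_zero_iff, star_trivial, sub_mulVec, dotProduct_sub, smul_mulVec,
      dotProduct_smul, smul_eq_mul, hc, div_mul_cancel₀ _ (hPpos x₀ hx₀0).ne', sub_self]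
  have h1 : x₀ ⬝ᵥ ((X - c • P) * A) *ᵥ x₀ = 0 := by
    have hv : x₀ ᵥ* (X - c • P) = 0 := by
      rw [← mulVec_transpose, ← conjTranspose_eq_transpose_of_trivial, hpsd.1.eq, hzero]
    rw [← mulVec_mulVec, dotProduct_mulVec, hv, zero_dotProduct]
  rw [Matrix.sub_mul, sub_mulVec, dotProduct_sub, Matrix.smul_mul, smul_mulVec, dotProduct_smul,
    smul_eq_mul] at h1
  nlinarith [h x₀ hx₀0, hPA x₀ hx₀0]

/-! ### The strict bounded real lemma by duality -/

/-- If `F G†` is skew-adjoint, then `F` and `G` are proportional along an orthonormal basis, with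
purely imaginary factors, up to the kernel of `G`. -/
theorem exists_orthonormalBasis_of_skew {E X : Type*} [NormedAddCommGroup E]
    [InnerProductSpace ℂ E] [FiniteDimensional ℂ E] [NormedAddCommGroup X]
    [InnerProductSpace ℂ X] [FiniteDimensional ℂ X] (F G : E →ₗ[ℂ] X)
    (h : ∀ v, F (G.adjoint v) = -G (F.adjoint v)) :
    ∃ (u : Finset E) (b : OrthonormalBasis u ℂ E),
      ∀ i, G (b i) = 0 ∨ ∃ ω : ℝ, F (b i) = (Complex.I * ω) • G (b i) := by
  set R : Submodule ℂ E := (LinearMap.ker G)ᗮ with hR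
  have hRrange : R = LinearMap.range G.adjoint := LinearMap.orthogonal_ker G
  have hinj : LinearMap.ker (G.domRestrict R) = ⊥ := by
    rw [LinearMap.ker_eq_bot']
    intro r hr
    have h1 : (r : E) ∈ LinearMap.ker G := LinearMap.mem_ker.2 hr
    have h2 := (Submodule.mem_orthogonal _ _).1 r.2 r h1
    exact Subtype.ext (inner_self_eq_zero.1 h2)
  obtain ⟨g, hg⟩ := (G.domRestrict R).exists_leftInverse_of_injective hinj
  have hgG : ∀ r : R, g (G r) = r := fun r => LinearMap.congr_fun hg r
  -- Skewness sends F(G†v) into the range of G, where `g` inverts G.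
  have hkey : ∀ r : R, G (g (F r)) = F r := by
    rintro ⟨r, hr⟩
    rw [hRrange] at hr
    obtain ⟨v, rfl⟩ := hr
    obtain ⟨a, ha, c, hc, hac⟩ := (LinearMap.ker G).exists_add_mem_mem_orthogonal (F.adjoint v)
    have h1 : F (G.adjoint v) = G ((-⟨c, hc⟩ : R) : E) := by
      rw [h, hac, map_add, LinearMap.mem_ker.1 ha, zero_add]
      simp
    simp only [h1, hgG]
  -- Skewness of F G† makes this operator self-adjoint; a real eigenvalue λ gives F e = -iλ G e.
  -- Basis vectors added outside R lie in ker G.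
  set T : R →ₗ[ℂ] R := Complex.I • (g ∘ₗ F.domRestrict R) with hT
  have hTapply : ∀ r : R, T r = Complex.I • g (F r) := fun r => rfl
  have hsym : T.IsSymmetric := by
    intro r r'
    obtain ⟨v, hv⟩ := hRrange.le r.2
    obtain ⟨v', hv'⟩ := hRrange.le r'.2
    rw [hTapply, hTapply, inner_smul_left, inner_smul_right, Submodule.coe_inner,
      Submodule.coe_inner]
    conv_lhs => rw [← hv', LinearMap.adjoint_inner_right, hkey, ← hv, h, inner_neg_left,
      ← LinearMap.adjoint_inner_right, ← LinearMap.adjoint_inner_right, LinearMap.adjoint_adjoint,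
      hv']
    conv_rhs => rw [← hv, LinearMap.adjoint_inner_left, hkey]
    simp
  set e := hsym.eigenvectorBasis rfl with he
  have hon : Orthonormal ℂ (fun i => (e i : E)) :=
    e.orthonormal.comp_linearIsometry R.subtypeₗᵢ
  obtain ⟨u, b, hsub, hb⟩ := hon.toSubtypeRange.exists_orthonormalBasis_extension
  refine ⟨u, b, fun i => ?_⟩
  rw [hb]
  by_cases hi : (i : E) ∈ Set.range fun i => (e i : E)
  · right
    obtain ⟨j, hj⟩ := hi
    refine ⟨-hsym.eigenvalues rfl j, ?_⟩
    have h1 : Complex.I • g (F (e j)) = ((hsym.eigenvalues rfl j : ℝ) : ℂ) • e j := by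
      rw [← hTapply]; exact hsym.apply_eigenvectorBasis rfl j
    have h2 := congrArg (fun r : R => G r) h1
    simp only [Submodule.coe_smul, map_smul, hkey] at h2
    rw [← hj]
    have h3 := congrArg (fun y => (-Complex.I) • y) h2
    simp only [smul_smul] at h3
    rw [neg_mul, Complex.I_mul_I, neg_neg, one_smul] at h3
    simp only [h3]
    congr 1
    push_cast
    ring
  · left
    have horth : ∀ j, inner ℂ (e j : E) (i : E) = 0 := by
      intro j
      have hj : (e j : E) ∈ u := hsub ⟨j, rfl⟩
      have := b.orthonormal.2 (i := ⟨e j, hj⟩) (j := i) (fun hij => hi ⟨j, by rw [← hij]⟩)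
      simpa [hb] using this
    have : (i : E) ∈ Rᗮ := by
      rw [Submodule.mem_orthogonal]
      intro r hr
      have h1 := e.sum_repr ⟨r, hr⟩
      have h2 := congrArg (fun y : R => (y : E)) h1
      simp only [Submodule.coe_sum, Submodule.coe_smul] at h2
      rw [← h2, sum_inner]
      exact Finset.sum_eq_zero fun j _ => by rw [inner_smul_left, horth, mul_zero]
    rw [hR, Submodule.orthogonal_orthogonal] at this
    exact LinearMap.mem_ker.1 this

theorem exists_unitary_of_skew {n q : Type} [Fintype n] [Fintype q] [DecidableEq n]
    [DecidableEq q] (F G : Matrix n q ℂ) (h : F * Gᴴ + G * Fᴴ = 0) :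
    ∃ (ι : Type) (_ : Fintype ι) (V : Matrix q ι ℂ), V * Vᴴ = 1 ∧
      ∀ k, G *ᵥ V.col k = 0 ∨ ∃ ω : ℝ, F *ᵥ V.col k = (Complex.I * ω) • (G *ᵥ V.col k) := by
  obtain ⟨u, b, hb⟩ := exists_orthonormalBasis_of_skew (toEuclideanLin F) (toEuclideanLin G) (by
    intro v
    rw [← toEuclideanLin_conjTranspose_eq_adjoint, ← toEuclideanLin_conjTranspose_eq_adjoint]
    simp only [toLpLin_apply, mulVec_mulVec]
    rw [eq_neg_of_add_eq_zero_left h, neg_mulVec]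
    rfl)
  refine ⟨u, inferInstance, Matrix.of fun i k => WithLp.ofLp (b k) i, ?_, ?_⟩
  · ext i j
    have h1 := b.sum_inner_mul_inner (EuclideanSpace.single i (1 : ℂ)) (EuclideanSpace.single j 1)
    simp only [EuclideanSpace.inner_single_left, EuclideanSpace.inner_single_right, map_one,
      one_mul] at h1
    simp only [mul_apply, conjTranspose_apply, of_apply, one_apply]
    refine h1.trans ?_
    simp [PiLp.single_apply, eq_comm]
  · intro k
    rcases hb k with h1 | ⟨ω, h1⟩
    · left
      exact congrArg WithLp.ofLp h1
    · right
      exact ⟨ω, congrArg WithLp.ofLp h1⟩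

/-- The Frobenius norm is unchanged by V because V Vᴴ = 1; this splits traces into contributions of
single frequencies. -/
theorem trace_mul_transpose_eq_sum {p q ι : Type*} [Fintype p] [Fintype q] [DecidableEq q]
    [Fintype ι] (N : Matrix p q ℝ) {V : Matrix q ι ℂ} (hV : V * Vᴴ = 1) :
    trace (N * Nᵀ) = ∑ k, ∑ i, ‖(N.map Complex.ofReal *ᵥ V.col k) i‖ ^ 2 := by
  set M := N.map Complex.ofReal with hM
  have h1 : ((trace (N * Nᵀ) : ℝ) : ℂ) = trace (M * Mᴴ) := by
    rw [hM, map_ofReal_conjTranspose, ← map_ofReal_mul]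
    simp [trace]
  have h2 : M * Mᴴ = (M * V) * (M * V)ᴴ := by
    rw [conjTranspose_mul, Matrix.mul_assoc, ← Matrix.mul_assoc V, hV, Matrix.one_mul]
  rw [← Complex.ofReal_inj, h1, h2, trace]
  push_cast
  rw [Finset.sum_comm]
  refine Finset.sum_congr rfl fun i _ => ?_
  rw [diag_apply, mul_apply]
  refine Finset.sum_congr rfl fun k _ => ?_
  rw [conjTranspose_apply, Complex.star_def, Complex.mul_conj, Complex.normSq_eq_norm_sq]
  push_cast
  rfl

/-- The strict bounded real lemma. -/
theorem IsHurwitz.exists_bounded_real {n m p : ℕ} {A : Matrix (Fin n) (Fin n) ℝ}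
    (hA : IsHurwitz A) (B : Matrix (Fin n) (Fin m) ℝ) (C : Matrix (Fin p) (Fin n) ℝ) {γ₀ γ : ℝ}
    (h0 : 0 ≤ γ₀) (hγ : γ₀ < γ)
    (hfreq : ∀ (ω : ℝ) (x : Fin n → ℂ) (u : Fin m → ℂ),
      A.map Complex.ofReal *ᵥ x + B.map Complex.ofReal *ᵥ u = (Complex.I * ω) • x →
      ∑ i, ‖(C.map Complex.ofReal *ᵥ x) i‖ ^ 2 ≤ γ₀ ^ 2 * ∑ i, ‖u i‖ ^ 2) :
    ∃ X : Matrix (Fin n) (Fin n) ℝ, X.IsHermitian ∧ ∀ (x : Fin n → ℝ) (u : Fin m → ℝ),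
      Sum.elim x u ≠ 0 →
      2 * (x ⬝ᵥ X *ᵥ (A *ᵥ x + B *ᵥ u)) + C *ᵥ x ⬝ᵥ C *ᵥ x - γ ^ 2 * (u ⬝ᵥ u) < 0 := by
  by_contra hcon
  obtain ⟨Z, hZ, hZ0, hl, hM⟩ := exists_posSemidef_of_not_exists_neg
    (V := Matrix (Fin n) (Fin n) ℝ)
    -- Only the quadratic form matters, so the lower left block need not be filled in symmetrically.
    (l := { toFun := fun Y => fromBlocks (symMul A Y) (symMul B Y) 0 0
            map_add' := fun X Y => by
              rw [map_add, map_add, fromBlocks_add]; simp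
            map_smul' := fun c Y => by
              rw [map_smul, map_smul, RingHom.id_apply, fromBlocks_smul]; simp })
    (M := fromBlocks (Cᵀ * C) 0 0 (-(γ ^ 2 • (1 : Matrix (Fin m) (Fin m) ℝ)))) (by
      rintro ⟨Y, hY⟩
      apply hcon
      refine ⟨(1 / 2 : ℝ) • (Y + Yᵀ), ?_, ?_⟩
      · rw [IsHermitian, conjTranspose_eq_transpose_of_trivial, transpose_smul, transpose_add,
          transpose_transpose, add_comm]
      · intro x u hxu
        have := hY _ hxu
        simp only [LinearMap.coe_mk, AddHom.coe_mk, fromBlocks_add, symMul_apply] at this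
        rw [dotProduct_fromBlocks_mulVec] at this
        have e1 : x ⬝ᵥ Cᵀ *ᵥ C *ᵥ x = C *ᵥ x ⬝ᵥ C *ᵥ x := by
          rw [dotProduct_mulVec, vecMul_transpose]
        simp only [add_zero, zero_add, zero_mulVec, dotProduct_zero, neg_mulVec, smul_mulVec,
          one_mulVec, dotProduct_neg, dotProduct_smul, smul_eq_mul, add_mulVec _ (Cᵀ * C),
          dotProduct_add, ← mulVec_mulVec, e1] at this
        rw [smul_mulVec, dotProduct_smul, mulVec_add, dotProduct_add, smul_eq_mul]
        linarith)
  obtain ⟨k, R, rfl⟩ := exists_eq_transpose_mul_self hZ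
  obtain ⟨G, E, rfl⟩ : ∃ (G : Matrix (Fin n) (Fin k) ℝ) (E : Matrix (Fin m) (Fin k) ℝ),
      R = fromCols Gᵀ Eᵀ :=
    ⟨R.toCols₁ᵀ, R.toCols₂ᵀ, by simp⟩
  rw [transpose_fromCols, transpose_transpose, transpose_transpose, fromRows_mul_fromCols] at *
  -- Stationarity of the multiplier Z = [G; E][G; E]ᵀ against every Y.
  have hskew : (A * G + B * E) * Gᵀ + G * (A * G + B * E)ᵀ = 0 := by
    apply eq_zero_of_forall_trace_mul
    intro Y
    have h := hl Y
    simp only [LinearMap.coe_mk, AddHom.coe_mk, symMul_apply, fromBlocks_multiply,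
      trace_fromBlocks, Matrix.mul_zero, add_zero] at h
    rw [trace_mul_symm_mul, trace_mul_symm_mul, ← trace_add, ← Matrix.add_mul] at h
    rw [← h]
    congr 2
    simp only [transpose_add, transpose_mul, transpose_transpose, Matrix.mul_add, Matrix.add_mul,
      Matrix.mul_assoc]
    abel
  have htr : 0 ≤ trace ((C * G) * (C * G)ᵀ) - γ ^ 2 * trace (E * Eᵀ) := by
    simp only [fromBlocks_multiply, trace_fromBlocks, Matrix.mul_zero, add_zero, zero_add,
      Matrix.mul_neg, trace_neg, Matrix.mul_smul, Matrix.mul_one, trace_smul, smul_eq_mul] at hM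
    have e1 : trace (C * G * (C * G)ᵀ) = trace (G * Gᵀ * (Cᵀ * C)) := by
      rw [transpose_mul, Matrix.mul_assoc, trace_mul_comm]
      simp only [Matrix.mul_assoc]
    rw [e1]
    linarith
  obtain ⟨ι, _, V, hV, hVk⟩ := exists_unitary_of_skew ((A * G + B * E).map Complex.ofReal)
    (G.map Complex.ofReal) (by
      rw [map_ofReal_conjTranspose, map_ofReal_conjTranspose, ← map_ofReal_mul, ← map_ofReal_mul,
        ← map_ofReal_add, hskew]
      ext i j; simp)
  have hF : ∀ v, (A * G + B * E).map Complex.ofReal *ᵥ v = A.map Complex.ofReal *ᵥ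
      (G.map Complex.ofReal *ᵥ v) + B.map Complex.ofReal *ᵥ (E.map Complex.ofReal *ᵥ v) := by
    intro v
    rw [map_ofReal_add, map_ofReal_mul, map_ofReal_mul, add_mulVec, mulVec_mulVec, mulVec_mulVec]
  have hCG : ∀ v, (C * G).map Complex.ofReal *ᵥ v = C.map Complex.ofReal *ᵥ
      (G.map Complex.ofReal *ᵥ v) := by
    intro v
    rw [map_ofReal_mul, mulVec_mulVec]
  have hterm : ∀ j, ∑ i, ‖((C * G).map Complex.ofReal *ᵥ V.col j) i‖ ^ 2 ≤
      γ₀ ^ 2 * ∑ i, ‖(E.map Complex.ofReal *ᵥ V.col j) i‖ ^ 2 := by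
    intro j
    rw [hCG]
    rcases hVk j with h | ⟨ω, h⟩
    · rw [h, mulVec_zero]
      simpa using by positivity
    · rw [hF] at h
      exact hfreq ω _ _ h
  rw [trace_mul_transpose_eq_sum _ hV, trace_mul_transpose_eq_sum _ hV] at htr
  -- The multiplier gives ‖CG‖² ≥ γ²‖E‖² and the frequency bound gives ‖CG‖² ≤ γ₀²‖E‖², in Frobenius
  -- norms; as γ₀ < γ, E = 0. A nonzero Gv would then be an eigenvector of A with imaginary
  -- eigenvalue.
  have hE0 : ∑ j, ∑ i, ‖(E.map Complex.ofReal *ᵥ V.col j) i‖ ^ 2 = 0 := by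
    have h1 := Finset.sum_le_sum fun j (_ : j ∈ Finset.univ) => hterm j
    rw [← Finset.mul_sum] at h1
    have h2 : 0 ≤ ∑ j, ∑ i, ‖(E.map Complex.ofReal *ᵥ V.col j) i‖ ^ 2 := by positivity
    have h3 : γ₀ ^ 2 < γ ^ 2 := by gcongr
    by_contra h4
    have : 0 < ∑ j, ∑ i, ‖(E.map Complex.ofReal *ᵥ V.col j) i‖ ^ 2 :=
      lt_of_le_of_ne h2 (Ne.symm h4)
    nlinarith
  have hEv : ∀ j, E.map Complex.ofReal *ᵥ V.col j = 0 := by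
    intro j
    rw [Finset.sum_eq_zero_iff_of_nonneg fun _ _ => by positivity] at hE0
    have h1 := hE0 j (Finset.mem_univ j)
    rw [Finset.sum_eq_zero_iff_of_nonneg fun _ _ => by positivity] at h1
    funext i
    simpa using h1 i (Finset.mem_univ i)
  have hGv : ∀ j, G.map Complex.ofReal *ᵥ V.col j = 0 := by
    intro j
    rcases hVk j with h | ⟨ω, h⟩
    · exact h
    · by_contra hne
      rw [hF, hEv, mulVec_zero, add_zero] at h
      have := hA _ (mem_spectrum_iff_exists_mulVec.2 ⟨_, hne, h⟩)
      simp at this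
  apply hZ0
  rw [← hZ.trace_eq_zero_iff, trace_fromBlocks, trace_mul_transpose_eq_sum G hV,
    trace_mul_transpose_eq_sum E hV, hE0]
  simp [hGv]

/-! ### The Riccati inequality -/

/-- The Riccati expression `A W + W Aᵀ + W Cᵀ C W + μ B Bᵀ` of the bounded real lemma. -/
def riccati {n m p : ℕ} (A : Matrix (Fin n) (Fin n) ℝ) (B : Matrix (Fin n) (Fin m) ℝ)
    (C : Matrix (Fin p) (Fin n) ℝ) (W : Matrix (Fin n) (Fin n) ℝ) (μ : ℝ) :
    Matrix (Fin n) (Fin n) ℝ :=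
  A * W + W * Aᵀ + W * (Cᵀ * C) * W + μ • (B * Bᵀ)

theorem star_dotProduct_self_eq {k : Type*} [Fintype k] (v : k → ℂ) :
    star v ⬝ᵥ v = ((∑ i, ‖v i‖ ^ 2 : ℝ) : ℂ) := by
  simp only [dotProduct, Pi.star_apply, Complex.star_def, Complex.conj_mul']
  push_cast
  rfl

section Riccati

variable {n m p : ℕ} {A : Matrix (Fin n) (Fin n) ℝ} {B : Matrix (Fin n) (Fin m) ℝ}
  {C : Matrix (Fin p) (Fin n) ℝ} {W : Matrix (Fin n) (Fin n) ℝ} {μ : ℝ}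

theorem star_dotProduct_riccati (hW : W.IsHermitian) (v : Fin n → ℂ) :
    star v ⬝ᵥ (riccati A B C W μ).map Complex.ofReal *ᵥ v =
      star v ⬝ᵥ A.map Complex.ofReal *ᵥ (W.map Complex.ofReal *ᵥ v) +
      star (star v ⬝ᵥ A.map Complex.ofReal *ᵥ (W.map Complex.ofReal *ᵥ v)) +
      ((∑ i, ‖(C.map Complex.ofReal *ᵥ (W.map Complex.ofReal *ᵥ v)) i‖ ^ 2 : ℝ) : ℂ) +
      ((μ * ∑ i, ‖((B.map Complex.ofReal)ᴴ *ᵥ v) i‖ ^ 2 : ℝ) : ℂ) := by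
  have hWc : (W.map Complex.ofReal)ᴴ = W.map Complex.ofReal := by
    rw [map_ofReal_conjTranspose, ← conjTranspose_eq_transpose_of_trivial, hW.eq]
  have e : (riccati A B C W μ).map Complex.ofReal =
      A.map Complex.ofReal * W.map Complex.ofReal +
      W.map Complex.ofReal * (A.map Complex.ofReal)ᴴ +
      W.map Complex.ofReal * ((C.map Complex.ofReal)ᴴ * C.map Complex.ofReal) *
        W.map Complex.ofReal +
      (μ : ℂ) • (B.map Complex.ofReal * (B.map Complex.ofReal)ᴴ) := by
    simp only [map_ofReal_conjTranspose, ← map_ofReal_mul, ← map_ofReal_add, riccati]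
    ext i j
    simp
  have hst : ∀ {q : ℕ} (N : Matrix (Fin q) (Fin n) ℂ) (x : Fin n → ℂ) (y : Fin q → ℂ),
      star x ⬝ᵥ Nᴴ *ᵥ y = star (N *ᵥ x) ⬝ᵥ y := by
    intro q N x y
    rw [star_mulVec, dotProduct_mulVec]
  rw [e, add_mulVec, add_mulVec, add_mulVec, dotProduct_add, dotProduct_add, dotProduct_add]
  congr 1
  · congr 1
    · congr 1
      · rw [mulVec_mulVec]
      · rw [← mulVec_mulVec]
        conv_lhs => rw [← hWc]
        rw [hst, hst]
        exact star_dotProduct _ _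
    · rw [← mulVec_mulVec, ← mulVec_mulVec, ← mulVec_mulVec]
      conv_lhs => enter [2, 1]; rw [← hWc]
      rw [hst, hst, star_dotProduct_self_eq]
  · rw [smul_mulVec, dotProduct_smul, ← mulVec_mulVec, smul_eq_mul, Complex.ofReal_mul,
      ← star_dotProduct_self_eq]
    conv_lhs => enter [2, 2, 1]; rw [← conjTranspose_conjTranspose (B.map Complex.ofReal)]
    rw [hst]

theorem posDef_map_ofReal (hW : W.PosDef) : (W.map Complex.ofReal).PosDef := by
  rw [(posSemidef_map_ofReal hW.posSemidef).posDef_iff_isUnit, isUnit_iff_isUnit_det]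
  have : (W.map Complex.ofReal).det = ((W.det : ℝ) : ℂ) :=
    (RingHom.map_det Complex.ofRealHom W).symm
  rw [this, isUnit_iff_ne_zero]
  exact_mod_cast hW.det_pos.ne'

theorem riccati_re_nonpos (hS : (-riccati A B C W μ).PosSemidef) (v : Fin n → ℂ) :
    (star v ⬝ᵥ (riccati A B C W μ).map Complex.ofReal *ᵥ v).re ≤ 0 := by
  have h := (posSemidef_map_ofReal hS).dotProduct_mulVec_nonneg v
  have e : (-riccati A B C W μ).map Complex.ofReal = -(riccati A B C W μ).map Complex.ofReal := by
    ext i j; simp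
  rw [e, neg_mulVec, dotProduct_neg] at h
  have := (Complex.le_def.1 h).1
  simpa using this

/-- Dissipation: the Riccati inequality bounds the frequency response. -/
theorem sum_sq_le_of_riccati (hW : W.PosDef) (hμ : 0 < μ)
    (hS : (-riccati A B C W μ).PosSemidef) {ω : ℝ} {x : Fin n → ℂ} {u : Fin m → ℂ}
    (h : A.map Complex.ofReal *ᵥ x + B.map Complex.ofReal *ᵥ u = (Complex.I * ω) • x) :
    ∑ i, ‖(C.map Complex.ofReal *ᵥ x) i‖ ^ 2 ≤ μ⁻¹ * ∑ i, ‖u i‖ ^ 2 := by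
  have hWc := posDef_map_ofReal hW
  obtain ⟨y, rfl⟩ : ∃ y, W.map Complex.ofReal *ᵥ y = x :=
    ⟨(W.map Complex.ofReal)⁻¹ *ᵥ x, by
      rw [mulVec_mulVec, mul_nonsing_inv _ ((isUnit_iff_isUnit_det _).1 hWc.isUnit), one_mulVec]⟩
  have h1 := riccati_re_nonpos hS y
  rw [star_dotProduct_riccati hW.1, eq_sub_of_add_eq h, dotProduct_sub, dotProduct_smul,
    smul_eq_mul] at h1
  have h2 : (star y ⬝ᵥ W.map Complex.ofReal *ᵥ y).im = 0 :=
    (Complex.le_def.1 (hWc.posSemidef.dotProduct_mulVec_nonneg y)).2.symm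
  have h3 : star y ⬝ᵥ B.map Complex.ofReal *ᵥ u = star ((B.map Complex.ofReal)ᴴ *ᵥ y) ⬝ᵥ u := by
    rw [star_mulVec, conjTranspose_conjTranspose, dotProduct_mulVec]
  rw [h3] at h1
  set q := (B.map Complex.ofReal)ᴴ *ᵥ y with hq
  -- The completed square; the term iω y*Wy is imaginary and drops out of the real part.
  have h4 : 0 ≤ ∑ i, ‖(μ : ℂ) * q i - u i‖ ^ 2 := by positivity
  have h5 : ∑ i, ‖(μ : ℂ) * q i - u i‖ ^ 2 =
      μ ^ 2 * ∑ i, ‖q i‖ ^ 2 - 2 * μ * (star q ⬝ᵥ u).re + ∑ i, ‖u i‖ ^ 2 := by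
    simp only [dotProduct, Complex.re_sum, Finset.mul_sum, ← Finset.sum_sub_distrib,
      ← Finset.sum_add_distrib]
    refine Finset.sum_congr rfl fun i _ => ?_
    simp only [← Complex.normSq_eq_norm_sq, Complex.normSq_apply, Pi.star_apply, Complex.star_def]
    simp
    ring
  simp only [Complex.add_re, Complex.sub_re, Complex.mul_re, Complex.ofReal_re, Complex.I_re,
    Complex.I_im, Complex.ofReal_im, Complex.star_def, Complex.conj_re, h2, Complex.mul_im] at h1
  rw [h5] at h4
  rw [inv_mul_eq_div, le_div_iff₀ hμ]
  nlinarith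

/-- Testing the inequality on a left eigenvector v gives 2 Re(s) v*Wv + ‖CWv‖² + μ‖Bᵀv‖² ≤ 0 with
every term nonnegative, so all vanish. The semidefinite form is then zero at v, hence the Riccati
matrix kills v, and what survives is AWv = -W Aᵀv. -/
theorem exists_left_eigenvector_of_riccati (hW : W.PosDef) (hμ : 0 < μ)
    (hS : (-riccati A B C W μ).PosSemidef) {s : ℂ}
    (hs : s ∈ spectrum ℂ (A.map Complex.ofReal)) (hs0 : 0 ≤ s.re) :
    ∃ v : Fin n → ℂ, v ≠ 0 ∧ (A.map Complex.ofReal)ᵀ *ᵥ v = s • v ∧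
      (B.map Complex.ofReal)ᵀ *ᵥ v = 0 ∧
      C.map Complex.ofReal *ᵥ (W.map Complex.ofReal *ᵥ v) = 0 ∧
      A.map Complex.ofReal *ᵥ (W.map Complex.ofReal *ᵥ v) =
        (-s) • (W.map Complex.ofReal *ᵥ v) := by
  have hWc := posDef_map_ofReal hW
  have hreal : ∀ {k l : ℕ} (N : Matrix (Fin k) (Fin l) ℝ),
      (N.map Complex.ofReal)ᴴ = (N.map Complex.ofReal)ᵀ := by
    intro k l N
    rw [map_ofReal_conjTranspose]
    rfl
  have hs' : s ∈ spectrum ℂ (A.map Complex.ofReal)ᵀ := by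
    rw [mem_spectrum_iff_isRoot_charpoly] at hs ⊢
    rwa [charpoly_transpose]
  obtain ⟨v, hv0, hv⟩ := mem_spectrum_iff_exists_mulVec.1 hs'
  have h1 := riccati_re_nonpos hS v
  have hvA : star v ⬝ᵥ A.map Complex.ofReal *ᵥ (W.map Complex.ofReal *ᵥ v) =
      star s * (star v ⬝ᵥ W.map Complex.ofReal *ᵥ v) := by
    have h2 := congrArg star hv
    rw [← hreal, star_mulVec, conjTranspose_conjTranspose, star_smul] at h2
    rw [dotProduct_mulVec, h2, smul_dotProduct, smul_eq_mul]
  rw [star_dotProduct_riccati hW.1, hvA] at h1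
  have hpos := hWc.re_dotProduct_pos hv0
  have him : (star v ⬝ᵥ W.map Complex.ofReal *ᵥ v).im = 0 :=
    (Complex.le_def.1 (hWc.posSemidef.dotProduct_mulVec_nonneg v)).2.symm
  simp only [Complex.add_re, Complex.mul_re, Complex.ofReal_re, Complex.star_def, Complex.conj_re,
    him, mul_zero, sub_zero] at h1
  simp only [RCLike.re_to_complex] at hpos
  have hC : 0 ≤ ∑ i, ‖(C.map Complex.ofReal *ᵥ (W.map Complex.ofReal *ᵥ v)) i‖ ^ 2 := by
    positivity
  have hB : 0 ≤ ∑ i, ‖((B.map Complex.ofReal)ᴴ *ᵥ v) i‖ ^ 2 := by positivity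
  have hsw := mul_nonneg hs0 hpos.le
  have hμB := mul_nonneg hμ.le hB
  have hC0 : ∑ i, ‖(C.map Complex.ofReal *ᵥ (W.map Complex.ofReal *ᵥ v)) i‖ ^ 2 = 0 := by
    linarith
  have hB0 : ∑ i, ‖((B.map Complex.ofReal)ᴴ *ᵥ v) i‖ ^ 2 = 0 := by
    have : μ * ∑ i, ‖((B.map Complex.ofReal)ᴴ *ᵥ v) i‖ ^ 2 = 0 := by linarith
    exact (mul_eq_zero.1 this).resolve_left hμ.ne'
  have hsre : s.re = 0 := by
    have : s.re * (star v ⬝ᵥ W.map Complex.ofReal *ᵥ v).re = 0 := by linarith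
    exact (mul_eq_zero.1 this).resolve_right hpos.ne'
  have hvanish : ∀ {k : ℕ} {w : Fin k → ℂ}, ∑ i, ‖w i‖ ^ 2 = 0 → w = 0 := by
    intro k w hw
    rw [Finset.sum_eq_zero_iff_of_nonneg fun _ _ => by positivity] at hw
    funext i
    simpa using hw i (Finset.mem_univ i)
  have hCv := hvanish hC0
  have hBv := hvanish hB0
  refine ⟨v, hv0, hv, by rw [← hreal, hBv], hCv, ?_⟩
  have hSv : (riccati A B C W μ).map Complex.ofReal *ᵥ v = 0 := by
    have e : (-riccati A B C W μ).map Complex.ofReal =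
        -(riccati A B C W μ).map Complex.ofReal := by
      ext i j; simp
    have hz := ((posSemidef_map_ofReal hS).dotProduct_mulVec_zero_iff v).1 (by
      rw [e, neg_mulVec, dotProduct_neg, neg_eq_zero, star_dotProduct_riccati hW.1, hvA, hC0, hB0]
      apply Complex.ext
      · simp [hsre, him]
      · simp only [Complex.add_im, Complex.mul_im, Complex.star_def, Complex.conj_im,
          Complex.conj_re, map_mul, Complex.conj_conj, him]
        simp)
    rwa [e, neg_mulVec, neg_eq_zero] at hz
  have e : (riccati A B C W μ).map Complex.ofReal =
      A.map Complex.ofReal * W.map Complex.ofReal +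
      W.map Complex.ofReal * (A.map Complex.ofReal)ᵀ +
      W.map Complex.ofReal * ((C.map Complex.ofReal)ᴴ * C.map Complex.ofReal) *
        W.map Complex.ofReal +
      (μ : ℂ) • (B.map Complex.ofReal * (B.map Complex.ofReal)ᴴ) := by
    rw [← hreal]
    simp only [map_ofReal_conjTranspose, ← map_ofReal_mul, ← map_ofReal_add, riccati]
    ext i j
    simp
  rw [e, add_mulVec, add_mulVec, add_mulVec, smul_mulVec, ← mulVec_mulVec, ← mulVec_mulVec,
    ← mulVec_mulVec, ← mulVec_mulVec, ← mulVec_mulVec, ← mulVec_mulVec, hv, hCv, hBv] at hSv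
  simp only [mulVec_zero, smul_zero, add_zero, mulVec_smul] at hSv
  rw [neg_smul]
  exact eq_neg_of_add_eq_zero_left hSv

/-- The strict bounded real lemma for a system with a symmetry `J`: the Riccati inequality has a
solution that commutes with `J`. -/
theorem IsHurwitz.exists_riccati (hA : IsHurwitz A) {γ₀ γ : ℝ} (h0 : 0 ≤ γ₀) (hγ : γ₀ < γ)
    (hfreq : ∀ (ω : ℝ) (x : Fin n → ℂ) (u : Fin m → ℂ),
      A.map Complex.ofReal *ᵥ x + B.map Complex.ofReal *ᵥ u = (Complex.I * ω) • x →
      ∑ i, ‖(C.map Complex.ofReal *ᵥ x) i‖ ^ 2 ≤ γ₀ ^ 2 * ∑ i, ‖u i‖ ^ 2)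
    {J : Matrix (Fin n) (Fin n) ℝ} {J' : Matrix (Fin m) (Fin m) ℝ} (hJt : Jᵀ = J)
    (hJ : J * J = 1) (hJt' : J'ᵀ = J') (hJ' : J' * J' = 1) (hJA : J * A = A * J)
    (hJB : J * B = B * J') (hJC : C * J = C) :
    ∃ W : Matrix (Fin n) (Fin n) ℝ, W.PosDef ∧ W * J = J * W ∧
      (-riccati A B C W (γ ^ 2)⁻¹).PosSemidef := by
  obtain ⟨X, hX, hlmi⟩ := hA.exists_bounded_real B C h0 hγ hfreq
  have hXt : Xᵀ = X := by rwa [IsHermitian, conjTranspose_eq_transpose_of_trivial] at hX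
  have hγ0 : 0 < γ ^ 2 := by
    have : 0 < γ := by linarith
    positivity
  -- The inequality is affine in X and invariant under (x, u) ↦ (Jx, J'u), so the average over J
  -- still solves it.
  set Y := (1 / 2 : ℝ) • (X + J * X * J) with hY
  have hYt : Yᵀ = Y := by
    simp only [hY, transpose_smul, transpose_add, transpose_mul, hXt, hJt, Matrix.mul_assoc]
  have hYherm : Y.IsHermitian := by rwa [IsHermitian, conjTranspose_eq_transpose_of_trivial]
  have hYJ : Y * J = J * Y := by
    simp only [hY, Matrix.smul_mul, Matrix.mul_smul, Matrix.add_mul, Matrix.mul_add, Matrix.mul_assoc,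
      hJ, Matrix.mul_one]
    rw [← Matrix.mul_assoc J J, hJ, Matrix.one_mul, add_comm]
  have hlmiY : ∀ (x : Fin n → ℝ) (u : Fin m → ℝ), Sum.elim x u ≠ 0 →
      2 * (x ⬝ᵥ Y *ᵥ (A *ᵥ x + B *ᵥ u)) + C *ᵥ x ⬝ᵥ C *ᵥ x - γ ^ 2 * (u ⬝ᵥ u) < 0 := by
    intro x u hxu
    have h1 := hlmi x u hxu
    have h2 := hlmi (J *ᵥ x) (J' *ᵥ u) (by
      intro hz
      apply hxu
      have hx : J *ᵥ x = 0 := by funext i; exact congrFun hz (Sum.inl i)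
      have hu : J' *ᵥ u = 0 := by funext i; exact congrFun hz (Sum.inr i)
      have hx' : x = 0 := by rw [← one_mulVec x, ← hJ, ← mulVec_mulVec, hx, mulVec_zero]
      have hu' : u = 0 := by rw [← one_mulVec u, ← hJ', ← mulVec_mulVec, hu, mulVec_zero]
      rw [hx', hu']
      ext (i | i) <;> rfl)
    have e1 : A *ᵥ J *ᵥ x + B *ᵥ J' *ᵥ u = J *ᵥ (A *ᵥ x + B *ᵥ u) := by
      rw [mulVec_mulVec, mulVec_mulVec, ← hJA, ← hJB, mulVec_add, mulVec_mulVec, mulVec_mulVec]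
    have e2 : C *ᵥ J *ᵥ x = C *ᵥ x := by rw [mulVec_mulVec, hJC]
    have e3 : J' *ᵥ u ⬝ᵥ J' *ᵥ u = u ⬝ᵥ u := by
      rw [dotProduct_mulVec, ← mulVec_transpose, hJt', mulVec_mulVec, hJ', one_mulVec]
    have e4 : ∀ w, J *ᵥ x ⬝ᵥ X *ᵥ J *ᵥ w = x ⬝ᵥ (J * X * J) *ᵥ w := by
      intro w
      rw [← mulVec_mulVec, ← mulVec_mulVec, dotProduct_mulVec x, ← mulVec_transpose, hJt]
    rw [e1, e2, e3, e4] at h2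
    rw [hY, smul_mulVec, dotProduct_smul, add_mulVec, dotProduct_add, smul_eq_mul]
    linarith
  have hYpd : Y.PosDef := hA.posDef_of_lyapunov hYherm (by
    intro x hx
    have h1 := hlmiY x 0 (fun hz => hx (by funext i; exact congrFun hz (Sum.inl i)))
    simp only [mulVec_zero, add_zero, dotProduct_zero, mul_zero, sub_zero] at h1
    rw [← mulVec_mulVec]
    have h2 : 0 ≤ C *ᵥ x ⬝ᵥ C *ᵥ x := by
      simpa using dotProduct_star_self_nonneg (C *ᵥ x)
    linarith)
  have hdet : IsUnit Y.det := (isUnit_iff_isUnit_det _).1 hYpd.isUnit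
  have hWt : (Y⁻¹)ᵀ = Y⁻¹ := by rw [transpose_nonsing_inv, hYt]
  refine ⟨Y⁻¹, hYpd.inv, ?_, ?_⟩
  · calc Y⁻¹ * J = Y⁻¹ * (J * Y) * Y⁻¹ := by
          rw [Matrix.mul_assoc, Matrix.mul_assoc, mul_nonsing_inv _ hdet, Matrix.mul_one]
      _ = J * Y⁻¹ := by
          rw [← hYJ, ← Matrix.mul_assoc, nonsing_inv_mul _ hdet, Matrix.one_mul]
  · refine PosSemidef.of_dotProduct_mulVec_nonneg ?_ ?_
    · rw [IsHermitian, conjTranspose_eq_transpose_of_trivial, transpose_neg, riccati]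
      simp only [transpose_add, transpose_mul, transpose_smul, transpose_transpose, hWt,
        Matrix.mul_assoc]
      congr 2
      rw [add_comm (A * Y⁻¹)]
    · intro v
      rw [star_trivial, neg_mulVec, dotProduct_neg, neg_nonneg]
      set x := Y⁻¹ *ᵥ v with hx
      set w := Bᵀ *ᵥ v with hw
      have hYx : Y *ᵥ x = v := by
        rw [hx, mulVec_mulVec, mul_nonsing_inv _ hdet, one_mulVec]
      -- The input γ⁻²Bᵀv maximizes the left side for x = Y⁻¹v; inserting it eliminates u and leaves
      -- the Riccati form at v.
      have h1 : 2 * (x ⬝ᵥ Y *ᵥ (A *ᵥ x + B *ᵥ ((γ ^ 2)⁻¹ • w))) + C *ᵥ x ⬝ᵥ C *ᵥ x -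
          γ ^ 2 * (((γ ^ 2)⁻¹ • w) ⬝ᵥ ((γ ^ 2)⁻¹ • w)) ≤ 0 := by
        by_cases hz : Sum.elim x ((γ ^ 2)⁻¹ • w) = 0
        · have hx0 : x = 0 := by funext i; exact congrFun hz (Sum.inl i)
          have hw0 : (γ ^ 2)⁻¹ • w = 0 := by funext i; exact congrFun hz (Sum.inr i)
          rw [hw0, hx0]
          simp
        · exact (hlmiY _ _ hz).le
      have e1 : ∀ y, x ⬝ᵥ Y *ᵥ y = v ⬝ᵥ y := by
        intro y
        rw [dotProduct_mulVec, ← mulVec_transpose, hYt, hYx]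
      have e2 : v ⬝ᵥ B *ᵥ w = w ⬝ᵥ w := by
        rw [dotProduct_mulVec, ← mulVec_transpose]
      have e3 : ∀ y, v ⬝ᵥ Y⁻¹ *ᵥ y = x ⬝ᵥ y := by
        intro y
        rw [dotProduct_mulVec, ← mulVec_transpose, hWt]
      have e4 : x ⬝ᵥ Aᵀ *ᵥ v = v ⬝ᵥ A *ᵥ x := by
        rw [dotProduct_mulVec, vecMul_transpose, dotProduct_comm]
      have e5 : x ⬝ᵥ Cᵀ *ᵥ C *ᵥ x = C *ᵥ x ⬝ᵥ C *ᵥ x := by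
        rw [dotProduct_mulVec, vecMul_transpose]
      rw [e1, mulVec_smul, dotProduct_add, dotProduct_smul, e2, smul_dotProduct, dotProduct_smul,
        smul_eq_mul, smul_eq_mul, mul_inv_cancel_left₀ hγ0.ne'] at h1
      rw [riccati, add_mulVec, add_mulVec, add_mulVec, dotProduct_add, dotProduct_add,
        dotProduct_add, smul_mulVec, dotProduct_smul, ← mulVec_mulVec, ← mulVec_mulVec,
        ← mulVec_mulVec, ← mulVec_mulVec, ← mulVec_mulVec, ← mulVec_mulVec, ← hx, ← hw, e2, e3, e3,
        e4, e5, smul_eq_mul]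
      linarith

end Riccati

/-! ### Singular values, blocks and the closed loop -/

theorem sum_sq_mulVec_le {k n : ℕ} (M : Matrix (Fin k) (Fin n) ℂ) {g : ℝ} (hg : sigmaMax M ≤ g)
    (u : Fin n → ℂ) : ∑ i, ‖(M *ᵥ u) i‖ ^ 2 ≤ g ^ 2 * ∑ i, ‖u i‖ ^ 2 := by
  have h1 := (LinearMap.toContinuousLinearMap (toEuclideanLin M)).le_of_opNorm_le hg
    (WithLp.toLp 2 u)
  have h2 := pow_le_pow_left₀ (norm_nonneg _) h1 2
  rw [mul_pow, EuclideanSpace.norm_sq_eq, EuclideanSpace.norm_sq_eq] at h2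
  exact h2

theorem sigmaMax_le {k n : ℕ} (M : Matrix (Fin k) (Fin n) ℂ) {g : ℝ} (hg : 0 ≤ g)
    (h : ∀ u, ∑ i, ‖(M *ᵥ u) i‖ ^ 2 ≤ g ^ 2 * ∑ i, ‖u i‖ ^ 2) : sigmaMax M ≤ g := by
  refine ContinuousLinearMap.opNorm_le_bound _ hg fun u => ?_
  refine (sq_le_sq₀ (norm_nonneg _) (by positivity)).1 ?_
  rw [mul_pow, EuclideanSpace.norm_sq_eq, EuclideanSpace.norm_sq_eq]
  exact h (WithLp.ofLp u)

theorem block₁_reindex_fromBlocks (a : Matrix (Fin 6) (Fin 6) ℝ) (b : Matrix (Fin 6) (Fin 1) ℝ)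
    (c : Matrix (Fin 1) (Fin 6) ℝ) (d : Matrix (Fin 1) (Fin 1) ℝ) :
    block₁ (reindex (finSumFinEquiv (m := 6) (n := 1)) (finSumFinEquiv (m := 6) (n := 1))
      (fromBlocks a b c d)) = a := by
  ext i j
  simp only [block₁, submatrix_apply, reindex_apply, finSumFinEquiv_symm_apply_castAdd,
    fromBlocks_apply₁₁]

theorem block₂_reindex_fromBlocks (a : Matrix (Fin 6) (Fin 6) ℝ) (b : Matrix (Fin 6) (Fin 1) ℝ)
    (c : Matrix (Fin 1) (Fin 6) ℝ) (d : Matrix (Fin 1) (Fin 1) ℝ) :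
    block₂ (reindex (finSumFinEquiv (m := 6) (n := 1)) (finSumFinEquiv (m := 6) (n := 1))
      (fromBlocks a b c d)) = b := by
  ext i j
  simp only [block₂, submatrix_apply, reindex_apply, finSumFinEquiv_symm_apply_castAdd,
    finSumFinEquiv_symm_apply_natAdd, fromBlocks_apply₁₂]

theorem exists_eq_reindex_fromBlocks {W : Matrix (Fin 7) (Fin 7) ℝ} (hW : Wᵀ = W) :
    ∃ d, W = reindex (finSumFinEquiv (m := 6) (n := 1)) (finSumFinEquiv (m := 6) (n := 1))
      (fromBlocks (block₁ W) (block₂ W) (block₂ W)ᵀ d) := by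
  refine ⟨W.submatrix (Fin.natAdd 6) (Fin.natAdd 6), ?_⟩
  rw [← Equiv.symm_apply_eq]
  ext (i | i) (j | j)
  · rfl
  · rfl
  · change W (Fin.natAdd 6 i) (Fin.castAdd 1 j) = W (Fin.castAdd 1 j) (Fin.natAdd 6 i)
    conv_lhs => rw [← hW]
    rfl
  · rfl

theorem L_apply (W : Matrix (Fin 7) (Fin 7) ℝ) (i : Fin 3) (j : Fin 4) :
    L W i j = W (Fin.castAdd 4 i) (Fin.natAdd 3 j) := by
  have h1 : ∀ k : Fin 7, (V₁ * W) i k = W (Fin.castAdd 4 i) k := by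
    intro k
    rw [mul_apply, ← (finSumFinEquiv (m := 3) (n := 4)).sum_comp, Fintype.sum_sum_type]
    simp [V₁, one_apply]
    rfl
  rw [L, mul_apply, ← (finSumFinEquiv (m := 3) (n := 4)).sum_comp, Fintype.sum_sum_type]
  simp [V₂, one_apply, h1]
  rfl

namespace Params

variable (P : Params)

theorem closedLoop_eq_of_pattern (kᵢ kₚ k_d : ℝ) :
    P.closedLoop !![0, 0, 0, -kᵢ, -kₚ, -k_d] =
      !![0, 1, 0, 0, 0, 0;
         0, 0, 1, 0, 0, 0;
         P.z₁, P.z₂, P.z₃, 0, 0, 0;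
         0, 0, 0, 0, 1, 0;
         0, 0, 0, 0, 0, 1;
         0, 0, 0, -(kᵢ / P.m), -(kₚ / P.m), -(P.d / P.m) - k_d / P.m] := by
  ext i j
  fin_cases i <;> fin_cases j <;>
    simp [closedLoop, A, B₂, div_eq_inv_mul]

theorem C_transpose_mul_D : P.Cᵀ * P.D = 0 := by
  ext i j
  fin_cases i <;> fin_cases j <;> simp [C, D, mul_apply, Fin.sum_univ_four]

/-- The corner W₃ never enters the leading block, and CᵀD = 0 removes the cross terms of (C - DK)ᵀ(C
- DK). -/
theorem block₁_Θ {W : Matrix (Fin 7) (Fin 7) ℝ} (hW : Wᵀ = W) (μ : ℝ)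
    {K : Matrix (Fin 1) (Fin 6) ℝ} (hK : block₂ W = block₁ W * Kᵀ) :
    block₁ (P.Θ W μ) = riccati (P.closedLoop K) P.B₁ (P.C - P.D * K) (block₁ W) μ := by
  obtain ⟨d, hd⟩ := exists_eq_reindex_fromBlocks hW
  have hW₁ : (block₁ W)ᵀ = block₁ W := by
    rw [block₁, transpose_submatrix, hW]
  have hDC : P.Dᵀ * P.C = 0 := by
    rw [← transpose_transpose (P.Dᵀ * P.C), transpose_mul, transpose_transpose,
      C_transpose_mul_D, transpose_zero]
  generalize block₁ W = W₁ at *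
  rw [hK] at hd
  subst hd
  have h := fun a b c d => block₁_reindex_fromBlocks a b c d
  have hadd : ∀ S T, block₁ (S + T) = block₁ S + block₁ T := fun _ _ => rfl
  have hsmul : ∀ (c : ℝ) T, block₁ (c • T) = c • block₁ T := fun _ _ => rfl
  simp only [reindex_apply] at h
  simp only [Θ, F, Q, R, reindex_apply, transpose_submatrix, submatrix_mul_equiv,
    fromBlocks_transpose, fromBlocks_multiply, hadd, hsmul, h]
  have e : (P.C - P.D * K)ᵀ * (P.C - P.D * K) = P.Cᵀ * P.C + Kᵀ * (P.Dᵀ * P.D) * K := by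
    rw [transpose_sub, transpose_mul, Matrix.sub_mul, Matrix.mul_sub, Matrix.mul_sub,
      ← Matrix.mul_assoc P.Cᵀ, C_transpose_mul_D, Matrix.mul_assoc Kᵀ, hDC]
    simp [Matrix.mul_assoc]
  rw [riccati, e, closedLoop]
  simp only [transpose_mul, transpose_transpose, hW₁, transpose_sub, transpose_neg,
    Matrix.add_mul, Matrix.mul_add, Matrix.sub_mul, Matrix.mul_sub, Matrix.neg_mul,
    Matrix.mul_neg, Matrix.mul_zero, Matrix.mul_assoc, add_zero, zero_add]
  abel

section Frequency

variable {P} {K : Matrix (Fin 1) (Fin 6) ℝ}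

theorem isUnit_resolvent (hK : P.IsStabilizing K) (ω : ℝ) :
    IsUnit ((Complex.I * (ω : ℂ)) • (1 : Matrix (Fin 6) (Fin 6) ℂ) -
      (P.closedLoop K).map Complex.ofReal).det := by
  rw [← isUnit_iff_isUnit_det]
  by_contra hcon
  have h : (Complex.I * (ω : ℂ)) ∈ spectrum ℂ ((P.closedLoop K).map Complex.ofReal) := by
    rw [spectrum.mem_iff, Algebra.algebraMap_eq_smul_one]
    exact hcon
  have := hK _ h
  simp at this

theorem transfer_mulVec (hK : P.IsStabilizing K) {ω : ℝ} {x u : Fin 6 → ℂ}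
    (h : (P.closedLoop K).map Complex.ofReal *ᵥ x + P.B₁.map Complex.ofReal *ᵥ u =
      (Complex.I * ω) • x) :
    P.transfer K (Complex.I * ω) *ᵥ u = (P.C - P.D * K).map Complex.ofReal *ᵥ x := by
  have hdet := isUnit_resolvent hK ω
  rw [transfer, ← mulVec_mulVec, eq_sub_of_add_eq' h, ← mulVec_mulVec]
  congr 1
  have : (Complex.I * (ω : ℂ)) • x - (P.closedLoop K).map Complex.ofReal *ᵥ x =
      ((Complex.I * (ω : ℂ)) • (1 : Matrix (Fin 6) (Fin 6) ℂ) -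
      (P.closedLoop K).map Complex.ofReal) *ᵥ x := by
    rw [sub_mulVec, smul_mulVec, one_mulVec]
  rw [this, mulVec_mulVec, nonsing_inv_mul _ hdet, one_mulVec]

theorem exists_state (hK : P.IsStabilizing K) (ω : ℝ) (u : Fin 6 → ℂ) :
    ∃ x, (P.closedLoop K).map Complex.ofReal *ᵥ x + P.B₁.map Complex.ofReal *ᵥ u =
      (Complex.I * ω) • x := by
  have hdet := isUnit_resolvent hK ω
  refine ⟨((Complex.I * (ω : ℂ)) • (1 : Matrix (Fin 6) (Fin 6) ℂ) -
      (P.closedLoop K).map Complex.ofReal)⁻¹ *ᵥ (P.B₁.map Complex.ofReal *ᵥ u), ?_⟩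
  set M := (Complex.I * (ω : ℂ)) • (1 : Matrix (Fin 6) (Fin 6) ℂ) -
      (P.closedLoop K).map Complex.ofReal with hM
  have h1 : M *ᵥ (M⁻¹ *ᵥ (P.B₁.map Complex.ofReal *ᵥ u)) = P.B₁.map Complex.ofReal *ᵥ u := by
    rw [mulVec_mulVec, mul_nonsing_inv _ hdet, one_mulVec]
  conv_lhs => enter [2]; rw [← h1]
  rw [← add_mulVec, hM, add_sub_cancel, smul_mulVec, one_mulVec]

theorem hInfNorm_le_of_riccati (hK : P.IsStabilizing K) {W : Matrix (Fin 6) (Fin 6) ℝ} {μ : ℝ}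
    (hW : W.PosDef) (hμ : 0 < μ)
    (hS : (-riccati (P.closedLoop K) P.B₁ (P.C - P.D * K) W μ).PosSemidef) :
    P.hInfNorm K ≤ ENNReal.ofReal (1 / Real.sqrt μ) := by
  refine iSup_le fun ω => ENNReal.ofReal_le_ofReal (sigmaMax_le _ (by positivity) fun u => ?_)
  obtain ⟨x, hx⟩ := exists_state hK ω u
  rw [transfer_mulVec hK hx, div_pow, one_pow, Real.sq_sqrt hμ.le, one_div]
  exact sum_sq_le_of_riccati hW hμ hS hx

theorem sum_sq_le_of_hInfNorm (hK : P.IsStabilizing K) {g : ℝ} (hg : 0 ≤ g)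
    (h : P.hInfNorm K ≤ ENNReal.ofReal g) (ω : ℝ) (x u : Fin 6 → ℂ)
    (hx : (P.closedLoop K).map Complex.ofReal *ᵥ x + P.B₁.map Complex.ofReal *ᵥ u =
      (Complex.I * ω) • x) :
    ∑ i, ‖((P.C - P.D * K).map Complex.ofReal *ᵥ x) i‖ ^ 2 ≤ g ^ 2 * ∑ i, ‖u i‖ ^ 2 := by
  rw [← transfer_mulVec hK hx]
  refine sum_sq_mulVec_le _ ?_ u
  exact (ENNReal.ofReal_le_ofReal_iff hg).1 ((le_iSup _ ω).trans h)

end Frequency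

end Params

/-! ### Feasible pairs and PID gains -/

theorem gain_mul_block₁ {W : Matrix (Fin 7) (Fin 7) ℝ} (hW : (block₁ W).PosDef) :
    gain W * block₁ W = (block₂ W)ᵀ := by
  rw [gain, Matrix.mul_assoc, nonsing_inv_mul _ ((isUnit_iff_isUnit_det _).1 hW.isUnit),
    Matrix.mul_one]

theorem block₂_eq_block₁_mul {W : Matrix (Fin 7) (Fin 7) ℝ} (hW : (block₁ W).PosDef) :
    block₂ W = block₁ W * (gain W)ᵀ := by
  have h1 := congrArg transpose (gain_mul_block₁ hW)
  have h2 : (block₁ W)ᵀ = block₁ W := by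
    rw [← conjTranspose_eq_transpose_of_trivial, hW.1.eq]
  rw [transpose_mul, transpose_transpose, h2] at h1
  exact h1.symm

theorem apply_eq_zero_of_L_eq_zero {W : Matrix (Fin 7) (Fin 7) ℝ} (hL : L W = 0) {i j : Fin 7}
    (hi : (i : ℕ) < 3) (hj : 3 ≤ (j : ℕ)) : W i j = 0 := by
  have h := congrFun (congrFun hL ⟨i, hi⟩) ⟨j - 3, by omega⟩
  rw [L_apply] at h
  have hj' : j = Fin.natAdd 3 (⟨j - 3, by omega⟩ : Fin 4) := by
    ext
    change (j : ℕ) = 3 + (j - 3)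
    omega
  rw [hj']
  exact h

theorem block₁_apply_eq_zero {W : Matrix (Fin 7) (Fin 7) ℝ} (hW : (block₁ W).PosDef)
    (hL : L W = 0) {i j : Fin 6} (h : (i < 3 ∧ 3 ≤ j) ∨ (3 ≤ i ∧ j < 3)) :
    block₁ W i j = 0 := by
  rcases h with ⟨hi, hj⟩ | ⟨hi, hj⟩
  · exact apply_eq_zero_of_L_eq_zero hL hi hj
  · have h1 := congrFun (congrFun hW.1 i) j
    rw [conjTranspose_apply, star_trivial] at h1
    rw [← h1]
    exact apply_eq_zero_of_L_eq_zero hL hj hi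

theorem block₂_apply_eq_zero {W : Matrix (Fin 7) (Fin 7) ℝ} (hL : L W = 0) {i : Fin 6}
    (hi : i < 3) : block₂ W i 0 = 0 :=
  apply_eq_zero_of_L_eq_zero hL hi (by simp)

theorem hasPIDPattern_of_apply_eq_zero {K : Matrix (Fin 1) (Fin 6) ℝ}
    (h : ∀ j < 3, K 0 j = 0) : HasPIDPattern K := by
  refine ⟨-K 0 3, -K 0 4, -K 0 5, ?_⟩
  ext i j
  fin_cases i
  fin_cases j
  · exact h 0 (by decide)
  · exact h 1 (by decide)
  · exact h 2 (by decide)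
  all_goals simp

theorem hasPIDPattern_gain {W : Matrix (Fin 7) (Fin 7) ℝ} (hW : (block₁ W).PosDef)
    (hL : L W = 0) : HasPIDPattern (gain W) := by
  -- Truncate K to its first three entries. Block diagonality and K W₁ = W₂ᵀ give k W₁ kᵀ = 0, so k
  -- = 0.
  set k : Fin 6 → ℝ := fun j => if j < 3 then gain W 0 j else 0 with hk
  have h1 : ∀ j < 3, (k ᵥ* block₁ W) j = 0 := by
    intro j hj
    have h2 := congrFun (congrFun (gain_mul_block₁ hW) 0) j
    rw [transpose_apply, block₂_apply_eq_zero hL hj, mul_apply] at h2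
    rw [← h2, vecMul, dotProduct]
    refine Finset.sum_congr rfl fun i _ => ?_
    by_cases hi : i < 3
    · simp [hk, hi]
    · rw [block₁_apply_eq_zero hW hL (Or.inr ⟨not_lt.1 hi, hj⟩), mul_zero, mul_zero]
  have hk0 : k = 0 := by
    by_contra hne
    have h2 := hW.dotProduct_mulVec_pos hne
    rw [star_trivial, dotProduct_mulVec] at h2
    refine h2.ne' ?_
    rw [dotProduct]
    refine Finset.sum_eq_zero fun j _ => ?_
    by_cases hj : j < 3
    · rw [h1 j hj, zero_mul]
    · simp [hk, hj]
  refine hasPIDPattern_of_apply_eq_zero fun j hj => ?_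
  have := congrFun hk0 j
  simpa [hk, hj] using this

namespace Params

variable {P : Params} {W : Matrix (Fin 7) (Fin 7) ℝ} {μ : ℝ}

theorem riccati_of_feasible (h : (W, μ) ∈ P.feasible) :
    (-riccati (P.closedLoop (gain W)) P.B₁ (P.C - P.D * gain W) (block₁ W) μ).PosSemidef := by
  obtain ⟨hW₁, hW, -, hΘ, -⟩ := h
  rw [← block₁_Θ P (by simpa using hW.1.eq) μ (block₂_eq_block₁_mul hW₁)]
  exact hΘ

theorem isStabilizing_of_feasible (hz : P.b 2 = 1 ∨ IsHurwitz P.Az) (he : P.b 5 = 1 ∨ P.q₁ ≠ 0)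
    (h : (W, μ) ∈ P.feasible) : P.IsStabilizing (gain W) := by
  have hS := riccati_of_feasible h
  obtain ⟨hW₁, -, hL, -, hμ⟩ := h
  intro s hs
  by_contra hcon
  push Not at hcon
  obtain ⟨v, hv0, hv, hBv, hCv, hAv⟩ := exists_left_eigenvector_of_riccati hW₁ hμ hS hs hcon
  obtain ⟨kᵢ, kₚ, k_d, hK⟩ := hasPIDPattern_gain hW₁ hL
  rw [hK, closedLoop_eq_of_pattern] at hv hAv
  have hv' := fun i => congrFun hv i
  have e0 := hv' 0
  have e1 := hv' 1
  have e2 := hv' 2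
  have e4 := hv' 4
  have e5 := hv' 5
  simp [mulVec, dotProduct, Fin.sum_univ_six] at e0 e1 e2 e4 e5
  have hB : ∀ i, P.b i = 1 → v i = 0 := by
    intro i hi
    have := congrFun hBv i
    simpa [B₁, mulVec_diagonal, diagonal_map, hi] using this
  have hvz : v 0 = 0 ∧ v 1 = 0 ∧ v 2 = 0 := by
    -- If b₃ = 1, then v vanishes in the last generator coordinate and the companion structure
    -- propagates this upwards; otherwise (v₀, v₁, v₂) would be a left eigenvector of A_z for an
    -- unstable s.
    rcases hz with hb | hAz
    · have h2 := hB 2 hb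
      rw [h2] at e1 e2
      have h1 : v 1 = 0 := by simpa using e2
      rw [h1] at e1
      exact ⟨by simpa using e1, h1, h2⟩
    · by_contra hne
      have hmem : s ∈ spectrum ℂ (P.Az.map Complex.ofReal) := by
        rw [mem_spectrum_iff_isRoot_charpoly, ← charpoly_transpose,
          ← mem_spectrum_iff_isRoot_charpoly, mem_spectrum_iff_exists_mulVec]
        refine ⟨![v 0, v 1, v 2], fun h0 => hne ?_, ?_⟩
        · exact ⟨congrFun h0 0, congrFun h0 1, congrFun h0 2⟩
        · ext i
          fin_cases i <;>
            simp [Az, mulVec, dotProduct, Fin.sum_univ_three, e0, e1, e2]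
      exact absurd (hAz s hmem) (not_lt.2 hcon)
  obtain ⟨hv00, hv01, hv02⟩ := hvz
  rcases he with hb | hq
  · have h5 := hB 5 hb
    rw [h5] at e4 e5
    have h4 : v 4 = 0 := by simpa using e5
    rw [h4] at e4
    have h3 : v 3 = 0 := by simpa using e4
    apply hv0
    ext i
    fin_cases i <;> assumption
  -- With q₁ ≠ 0, unobservability kills the integral state of x = W₁v, and A x = -s x carries this
  -- down the integrator chain. So W₁v = 0, against W₁ ≻ 0.
  · set x := (block₁ W).map Complex.ofReal *ᵥ v with hx
    have hxz : ∀ i < 3, x i = 0 := by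
      intro i hi
      rw [hx, mulVec, dotProduct]
      refine Finset.sum_eq_zero fun j _ => ?_
      by_cases hj : j < 3
      · have : v j = 0 := by
          fin_cases j
          · exact hv00
          · exact hv01
          · exact hv02
          all_goals exact absurd hj (by decide)
        rw [this, mul_zero]
      · rw [map_apply, block₁_apply_eq_zero hW₁ hL (Or.inl ⟨hi, not_lt.1 hj⟩), Complex.ofReal_zero,
          zero_mul]
    have hx3 : x 3 = 0 := by
      have hD : ∀ j, (P.D * gain W) 0 j = 0 := fun j => by
        rw [mul_apply, Fin.sum_univ_one]
        simp [D]
      have := congrFun hCv 0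
      simp [mulVec, dotProduct, Fin.sum_univ_six, Matrix.sub_apply, hD] at this
      simp [C] at this
      exact this.resolve_left hq
    have hx4 : x 4 = 0 := by
      have := congrFun hAv 3
      simp [mulVec, dotProduct, Fin.sum_univ_six, hx3] at this
      exact this
    have hx5 : x 5 = 0 := by
      have := congrFun hAv 4
      simp [mulVec, dotProduct, Fin.sum_univ_six, hx4] at this
      exact this
    have hx0 : x = 0 := by
      ext i
      fin_cases i
      · exact hxz 0 (by decide)
      · exact hxz 1 (by decide)
      · exact hxz 2 (by decide)
      all_goals assumption
    have := (posDef_map_ofReal hW₁).re_dotProduct_pos hv0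
    rw [← hx, hx0, dotProduct_zero] at this
    simp at this

/-- A stabilizing gain with the prescribed pattern and small norm gives a feasible pair. -/
theorem exists_feasible {K : Matrix (Fin 1) (Fin 6) ℝ} (hK : HasPIDPattern K)
    (hstab : P.IsStabilizing K) {γ₀ γ : ℝ} (h0 : 0 ≤ γ₀) (hγ : γ₀ < γ)
    (hnorm : P.hInfNorm K ≤ ENNReal.ofReal γ₀) : ∃ W, (W, (γ ^ 2)⁻¹) ∈ P.feasible := by
  -- Commuting with this reflection is the same as being block diagonal.
  set J : Matrix (Fin 6) (Fin 6) ℝ := diagonal ![-1, -1, -1, 1, 1, 1] with hJ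
  have hJt : Jᵀ = J := diagonal_transpose _
  have hJJ : J * J = 1 := by
    rw [hJ, diagonal_mul_diagonal, ← diagonal_one]
    congr 1
    ext i
    fin_cases i <;> simp
  obtain ⟨kᵢ, kₚ, k_d, hKeq⟩ := hK
  have hJA : J * P.closedLoop K = P.closedLoop K * J := by
    rw [hKeq, closedLoop_eq_of_pattern]
    ext i j
    rw [hJ, diagonal_mul, mul_diagonal]
    fin_cases i <;> fin_cases j <;> simp
  have hJC : (P.C - P.D * K) * J = P.C - P.D * K := by
    rw [hKeq]
    ext i j
    rw [hJ, mul_diagonal]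
    fin_cases i <;> fin_cases j <;> simp [C, D]
  have hJB : J * P.B₁ = P.B₁ * J := by
    rw [hJ, B₁, diagonal_mul_diagonal, diagonal_mul_diagonal]
    congr 1
    ext i
    exact mul_comm _ _
  obtain ⟨W, hW, hWJ, hS⟩ := IsHurwitz.exists_riccati hstab h0 hγ
    (sum_sq_le_of_hInfNorm hstab h0 hnorm) hJt hJJ hJt hJJ hJA hJB hJC
  have hWt : Wᵀ = W := by rw [← conjTranspose_eq_transpose_of_trivial, hW.1.eq]
  have hoff : ∀ i j : Fin 6, i < 3 → 3 ≤ j → W i j = 0 := by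
    intro i j hi hj
    have h1 := congrFun (congrFun hWJ i) j
    rw [hJ, diagonal_mul, mul_diagonal] at h1
    have hi' : (![-1, -1, -1, 1, 1, 1] : Fin 6 → ℝ) i = -1 := by
      fin_cases i <;> first | rfl | exact absurd hi (by decide)
    have hj' : (![-1, -1, -1, 1, 1, 1] : Fin 6 → ℝ) j = 1 := by
      fin_cases j <;> first | rfl | exact absurd hj (by decide)
    rw [hi', hj'] at h1
    linarith
  -- This is [I; K] W [I; K]ᵀ, hence semidefinite, and its gain is K.
  set W' : Matrix (Fin 7) (Fin 7) ℝ :=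
    reindex (finSumFinEquiv (m := 6) (n := 1)) (finSumFinEquiv (m := 6) (n := 1))
      (fromBlocks W (W * Kᵀ) (K * W) (K * W * Kᵀ)) with hW'
  have hb₁ : block₁ W' = W := block₁_reindex_fromBlocks _ _ _ _
  have hb₂ : block₂ W' = W * Kᵀ := block₂_reindex_fromBlocks _ _ _ _
  have hpsd : W'.PosSemidef := by
    have h1 : fromBlocks W (W * Kᵀ) (K * W) (K * W * Kᵀ) =
        fromRows 1 K * W * (fromRows 1 K)ᴴ := by
      rw [conjTranspose_eq_transpose_of_trivial, transpose_fromRows, fromRows_mul,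
        fromRows_mul_fromCols]
      simp
    rw [hW', h1, reindex_apply]
    exact (hW.posSemidef.mul_mul_conjTranspose_same _).submatrix _
  refine ⟨W', by rwa [hb₁], hpsd, ?_, ?_, ?_⟩
  · ext i j
    rw [L_apply, Matrix.zero_apply]
    have hi : (Fin.castAdd 4 i : Fin 7) = Fin.castAdd 1 (Fin.castAdd 3 i) := rfl
    rw [hi]
    -- The last column of L(W') comes from W₂, the other three from the off-diagonal block of W₁.
    refine Fin.lastCases ?_ (fun j => ?_) j
    · change block₂ W' (Fin.castAdd 3 i) 0 = 0
      rw [hb₂, mul_apply]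
      refine Finset.sum_eq_zero fun k _ => ?_
      by_cases hk : k < 3
      · have : K 0 k = 0 := by
          rw [hKeq]
          fin_cases k <;> first | rfl | exact absurd hk (by decide)
        rw [transpose_apply, this, mul_zero]
      · rw [hoff _ _ i.2 (not_lt.1 hk), zero_mul]
    · change block₁ W' (Fin.castAdd 3 i) (Fin.natAdd 3 j) = 0
      rw [hb₁]
      exact hoff _ _ i.2 (Nat.le_add_right 3 j)
  · rw [block₁_Θ P (by simpa using hpsd.1.eq) _ (by rw [hb₁, hb₂]), hb₁]
    exact hS
  · have : 0 < γ := by linarith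
    change 0 < (γ ^ 2)⁻¹
    positivity

/-- A norm below 1/√μ leaves room for some γ strictly between, and γ⁻² > μ would be feasible. The
gap supplies the slack needed by the strict bounded real lemma. -/
theorem le_hInfNorm_of_isMax (hμ : 0 < μ)
    (hmax : ∀ W' : Matrix (Fin 7) (Fin 7) ℝ, ∀ μ' : ℝ, (W', μ') ∈ P.feasible → μ' ≤ μ)
    {K : Matrix (Fin 1) (Fin 6) ℝ} (hK : HasPIDPattern K) (hstab : P.IsStabilizing K) :
    ENNReal.ofReal (1 / Real.sqrt μ) ≤ P.hInfNorm K := by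
  by_contra hcon
  push Not at hcon
  set g := (P.hInfNorm K).toReal with hg
  have hfin : ENNReal.ofReal g = P.hInfNorm K := ENNReal.ofReal_toReal hcon.ne_top
  have hg0 : 0 ≤ g := ENNReal.toReal_nonneg
  have hlt : g < 1 / Real.sqrt μ := by
    rw [← hfin] at hcon
    exact (ENNReal.ofReal_lt_ofReal_iff_of_nonneg hg0).1 hcon
  obtain ⟨γ, hγ₁, hγ₂⟩ := exists_between hlt
  obtain ⟨W', hW'⟩ := exists_feasible hK hstab hg0 hγ₁ hfin.ge
  have h1 := hmax _ _ hW'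
  have hγ0 : 0 < γ := by linarith
  have h2 : γ ^ 2 < μ⁻¹ := by
    have := pow_lt_pow_left₀ hγ₂ hγ0.le two_ne_zero
    rwa [div_pow, one_pow, Real.sq_sqrt hμ.le, one_div] at this
  have h3 := (lt_inv_comm₀ (by positivity) hμ).1 h2
  linarith

end Params

end Maglev
end

theorem theorem2 (P : Maglev.Params) (hm : 0 < P.m)
    (hb : ∀ i, P.b i = 0 ∨ P.b i = 1)
    (hz : P.b 2 = 1 ∨ Maglev.IsHurwitz P.Az)
    (he : P.b 5 = 1 ∨ P.q₁ ≠ 0) :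
    (∀ W : Matrix (Fin 7) (Fin 7) ℝ, ∀ μ : ℝ, (W, μ) ∈ P.feasible →
      (∀ i j : Fin 6, (i < 3 ∧ 3 ≤ j) ∨ (3 ≤ i ∧ j < 3) → Maglev.block₁ W i j = 0) ∧
      (∀ i : Fin 6, i < 3 → Maglev.block₂ W i 0 = 0) ∧
      P.IsStabilizing (Maglev.gain W) ∧
      Maglev.HasPIDPattern (Maglev.gain W) ∧
      0 < 1 / Real.sqrt μ ∧
      P.hInfNorm (Maglev.gain W) ≤ ENNReal.ofReal (1 / Real.sqrt μ)) ∧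
    (∀ W : Matrix (Fin 7) (Fin 7) ℝ, ∀ μ : ℝ, (W, μ) ∈ P.feasible →
      (∀ W' : Matrix (Fin 7) (Fin 7) ℝ, ∀ μ' : ℝ, (W', μ') ∈ P.feasible → μ' ≤ μ) →
      P.IsSparseOptimal (Maglev.gain W) ∧
      P.hInfNorm (Maglev.gain W) = ENNReal.ofReal (1 / Real.sqrt μ)) := by
  have hnorm : ∀ W : Matrix (Fin 7) (Fin 7) ℝ, ∀ μ : ℝ, (W, μ) ∈ P.feasible →
      P.hInfNorm (Maglev.gain W) ≤ ENNReal.ofReal (1 / Real.sqrt μ) := fun W μ h =>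
    Maglev.Params.hInfNorm_le_of_riccati (Maglev.Params.isStabilizing_of_feasible hz he h) h.1
      h.2.2.2.2 (Maglev.Params.riccati_of_feasible h)
  refine ⟨fun W μ h => ?_, fun W μ h hmax => ?_⟩
  · refine ⟨fun i j => Maglev.block₁_apply_eq_zero h.1 h.2.2.1,
      fun i => Maglev.block₂_apply_eq_zero h.2.2.1,
      Maglev.Params.isStabilizing_of_feasible hz he h, Maglev.hasPIDPattern_gain h.1 h.2.2.1,
      one_div_pos.2 (Real.sqrt_pos.2 h.2.2.2.2), hnorm W μ h⟩
  · have hpat := Maglev.hasPIDPattern_gain h.1 h.2.2.1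
    have hstab := Maglev.Params.isStabilizing_of_feasible hz he h
    exact ⟨⟨hpat, hstab, fun K hK hKs => (hnorm W μ h).trans
        (Maglev.Params.le_hInfNorm_of_isMax h.2.2.2.2 hmax hK hKs)⟩,
      (hnorm W μ h).antisymm (Maglev.Params.le_hInfNorm_of_isMax h.2.2.2.2 hmax hpat hstab)⟩
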